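/- Fix a base $b>1$ and write $\log=\log_b$. For every constant $C>0$ there is a constant $K>0$, depending only on $C$ and $b$, such that the following holds. Let $t,d,n\ge 1$ and $\ell\ge 0$ be integers and $\mu_4\ge 1$ a real number with $t\le d\le n$, $\ell\le\log n$ and $$t\log^6 n\;\le\;\mu_4 n+\frac{d^2}{t}\log^2 n .$$ Let $a_1,\dots,a_n\in\mathbb R^d$ be random vectors whose entries $a_{ij}$ ($i\in[n]$, $j\in[d]$) are jointly independent and satisfy $\mathbb E[a_{ij}^k]=0$ for all odd $k$, $\mathbb E[a_{ij}^2]\le 1$, $\mathbb E[a_{ij}^4]\le\mu_4$, and $|a_{ij}|\le\sqrt{C\log n}$ almost surely. View $a^{\otimes 4}$ as the $d^2\times d^2$ matrix with entries $(a^{\otimes 4})_{(j_1,j_2),(j_3,j_4)}=a_{j_1}a_{j_2}a_{j_3}a_{j_4}$. For a $d^2\times d^2$ matrix $A$ let $\mathsf{Shift}(A)$ be the $d^2\times d^2$ matrix with entries $$\mathsf{Shift}(A)_{(j_1,j_2),(j_3,j_4)}=\begin{cases}0 & \text{if } j_1=j_2\notin\{j_3,j_4\}\text{ or } j_3=j_4\notin\{j_1,j_2\},\\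 \tfrac32 A_{(j_1,j_2),(j_3,j_4)} & \text{if } j_1\ne j_2,\ j_3\ne j_4 \text{ and } |\{j_1,j_2,j_3,j_4\}|\le 3,\\ A_{(j_1,j_2),(j_3,j_4)} & \text{otherwise.}\end{cases}$$ Let $$M=t!\sum_{S\subseteq[n],\,|S|=t}\ \bigotimes_{i\in S}\mathsf{Shift}(a_i^{\otimes 4})\in\mathbb R^{d^{2t}\times d^{2t}},$$ with rows and columns indexed by $[d]^{2t}$ and the factors taken in increasing order of $i\in S$, and let $\widetilde M=\mathbb E_{\Pi,\Pi'}[\Pi M\Pi']$, where $\Pi,\Pi'$ are independent and uniformly distributed over the $d^{2t}\times d^{2t}$ permutation matrices that map an index $(j_1,\dots,j_{2t})$ to $(j_{\pi(1)},\dots,j_{\pi(2t)})$, $\pi$ being a uniformly random permutation of $\{1,\dots,2t\}$. Then $\operatorname{tr}(\widetilde M^{\ell})$ is integrable and $$\mathbb E\big[\operatorname{tr}(\widetilde M^{\ell})\big]\;\le\; d^{2t}\cdot\Big(K\Big(\mu_4 n+\frac{d^2}{t}\log^2 n\Big)\Big)^{t\ell}.$$ -/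

import Mathlib

open MeasureTheory ProbabilityTheory

namespace TraceBound

/-- `a^{⊗4}` of `a ∈ ℝ^d`, viewed as a `d² × d²` matrix with rows `(j₁, j₂)`, columns `(j₃, j₄)`. -/
def tensorFour {d : ℕ} (a : Fin d → ℝ) : Matrix (Fin d × Fin d) (Fin d × Fin d) ℝ :=
  Matrix.of fun p q => a p.1 * a p.2 * a q.1 * a q.2

/-- The matrix `Shift(A)`, for a `d² × d²` matrix `A` with rows `p = (j₁, j₂)` and columns
`q = (j₃, j₄)`. -/
noncomputable def Shift {d : ℕ} (A : Matrix (Fin d × Fin d) (Fin d × Fin d) ℝ) :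
    Matrix (Fin d × Fin d) (Fin d × Fin d) ℝ :=
  Matrix.of fun p q =>
    if (p.1 = p.2 ∧ p.1 ∉ ({q.1, q.2} : Finset (Fin d))) ∨
        (q.1 = q.2 ∧ q.1 ∉ ({p.1, p.2} : Finset (Fin d))) then 0
    else if p.1 ≠ p.2 ∧ q.1 ≠ q.2 ∧ ({p.1, p.2, q.1, q.2} : Finset (Fin d)).card ≤ 3 then
      3 / 2 * A p q
    else A p q

/-- The `k`-th consecutive pair of coordinates (`k = 0, …, t - 1`) of a multi-index
`J ∈ [d]^{2t}`. -/
def pairAt {d t : ℕ} (J : Fin (2 * t) → Fin d) (k : Fin t) : Fin d × Fin d :=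
  (J ⟨2 * k.1, by omega⟩, J ⟨2 * k.1 + 1, by omega⟩)

/-- The Kronecker product `B₀ ⊗ ⋯ ⊗ B_{t-1}` of `d² × d²` matrices, as a `d^{2t} × d^{2t}` matrix
whose rows and columns are indexed by `[d]^{2t}`. -/
def tensorProd {d t : ℕ} (B : Fin t → Matrix (Fin d × Fin d) (Fin d × Fin d) ℝ) :
    Matrix (Fin (2 * t) → Fin d) (Fin (2 * t) → Fin d) ℝ :=
  Matrix.of fun I J => ∏ k : Fin t, B k (pairAt I k) (pairAt J k)

/-- `M = t! ∑_{S ⊆ [n], |S| = t} ⨂_{i ∈ S} Shift(a_i^{⊗4})`, the factors of each product being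
taken in increasing order of `i ∈ S`. -/
noncomputable def bigM {n d : ℕ} (t : ℕ) (a : Fin n → Fin d → ℝ) :
    Matrix (Fin (2 * t) → Fin d) (Fin (2 * t) → Fin d) ℝ :=
  (t.factorial : ℝ) • ∑ S : {S : Finset (Fin n) // S.card = t},
    tensorProd fun k : Fin t => Shift (tensorFour (a (S.1.orderEmbOfFin S.2 k)))

/-- The permutation matrix that maps the basis vector of the index `J = (j_1, …, j_{2t})` to that
of `(j_{π(1)}, …, j_{π(2t)})`. -/
def permMat {d t : ℕ} (π : Equiv.Perm (Fin (2 * t))) :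
    Matrix (Fin (2 * t) → Fin d) (Fin (2 * t) → Fin d) ℝ :=
  Matrix.of fun I J => if I = J ∘ π then 1 else 0

/-- The symmetrization of `M`: the average of `Π M Π'` over independent uniformly random
permutations `π, π'` of the `2t` coordinates. -/
noncomputable def symM {n d : ℕ} (t : ℕ) (a : Fin n → Fin d → ℝ) :
    Matrix (Fin (2 * t) → Fin d) (Fin (2 * t) → Fin d) ℝ :=
  (((2 * t).factorial : ℝ) ^ 2)⁻¹ •
    ∑ π : Equiv.Perm (Fin (2 * t)), ∑ π' : Equiv.Perm (Fin (2 * t)),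
      permMat π * bigM t a * permMat π'

end TraceBound

/-! Write `L = log n`, `x = d / t` and `q = (μ₄ n + (d² / t) L²) / t`; the hypotheses give `L ^ 6 ≤
q`, `(x * L) ^ 2 ≤ q` and `μ₄ n ≤ t * q`. The trace expands into a sum over closed walks of indices,
coordinate permutations and `t`-sets, each term being a product of entries, one for each slot. A
term has mean zero unless every entry occurs an even number of times. So the slots fall into even
classes by vector and label, and the sum is organised by this partition `R`.

For fixed `R`, row slots of one factor and column slots of the preceding factor read the same index
of the walk. Joining these links to `R` leaves `κ` classes, hence at most `d ^ κ = x ^ κ * t ^ κ`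
walks. For all permutations `κ ≤ 2 * t + u`, where `u` counts the classes of `R` in which a column
slot comes first (`card_walkSetoid_le`). The average of `t ^ κ` over the row permutations is at most
`8 ^ t` per factor (`sum_pow_card_walkSetoid_le`): refine the even classes to pairs and expose the
links one by one; at each link at most one target fails to merge two classes.

The rest is done vector by vector. Let a vector occur in `m` factors, with `k` classes, `u` of them
column-first. The row slots of its first factor are not in column-first classes, so `u + 2 ≤ k ≤ 2 *
m` if their labels differ. If they agree, `Shift` forces a third equal label and parity a fourth, so
`u + 1 ≤ k ≤ 2 * m - 1` (`colFirst_add_le`). The moments cost `μ₄ * (c * L) ^ (2 * m - k - 1)` and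
the choice of `R` costs `(2 * m) ^ (4 * m - k)`; together with `x ^ u` this is at most `μ₄ * (64 * c
^ 2) ^ m * m ^ m * q ^ (m - 1) / L ^ (m - 1)` (`vector_weight_le`). The gain `L ^ (m - 1)` pays for
the choice of the `t`-sets, which are summed by a generating function (`sum_prod_vectorWeight_le`).
-/

namespace TraceBound

/-! ### Exposing a random matching edge by edge -/

section Exposure

variable {V : Type*}

/-- No three distinct elements of `W` have the same colour. -/
def AtMostTwo (g : V → V) (W : Set V) : Prop :=
  ∀ a ∈ W, ∀ b ∈ W, ∀ c ∈ W, g a = g b → g a = g c → a = b ∨ a = c ∨ b = c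

lemma AtMostTwo.mono {g : V → V} {W W' : Set V} (h : AtMostTwo g W) (hs : W' ⊆ W) :
    AtMostTwo g W' :=
  fun a ha b hb c hc => h a (hs ha) b (hs hb) c (hs hc)

variable [DecidableEq V]

/-- Identify the colour classes of `x` and `y`. -/
def glue (g : V → V) (x y : V) : V → V := fun v => if g v = g y then g x else g v

/-- Each of the two glued colours has at most one point besides `x` and `y`, so without these the
merged colour has at most two. -/
lemma AtMostTwo.glue {g : V → V} {W : Set V} (h : AtMostTwo g W) {x y : V} (hx : x ∈ W)
    (hy : y ∈ W) (hxy : x ≠ y) : AtMostTwo (glue g x y) (W \ {x, y}) := by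
  rintro a ⟨ha, ha'⟩ b ⟨hb, hb'⟩ c ⟨hc, hc'⟩ hab hac
  have h1 := h a ha b hb c hc
  have h2 := h a ha b hb x hx
  have h3 := h a ha b hb y hy
  have h4 := h a ha c hc x hx
  have h5 := h a ha c hc y hy
  have h6 := h b hb c hc x hx
  have h7 := h b hb c hc y hy
  have h8 := h a ha x hx y hy
  have h9 := h b hb x hx y hy
  have h10 := h c hc x hx y hy
  simp only [Set.mem_insert_iff, Set.mem_singleton_iff, not_or] at ha' hb' hc'
  simp only [TraceBound.glue] at hab hac
  grind

/-- A map all of whose fibres are even can be refined to one whose fibres are pairs. -/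
lemma exists_pairing {β : Type*} [DecidableEq β] (k : V → β) (n : ℕ) :
    ∀ s : Finset V, s.card = n → (∀ b, Even (s.filter fun v => k v = b).card) →
      ∃ g : V → V, (∀ a ∈ s, g a ∈ s) ∧ (∀ a ∈ s, ∀ b ∈ s, g a = g b → k a = k b) ∧
        AtMostTwo g s ∧ 2 * (s.image g).card = s.card := by
  induction n using Nat.strong_induction_on with
  | _ n ih =>
    intro s hs heven
    rcases s.eq_empty_or_nonempty with rfl | ⟨a, ha⟩
    · exact ⟨id, by simp, by simp, by simp [AtMostTwo], by simp⟩
    have ha' : a ∈ s.filter fun v => k v = k a := by simp [ha]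
    obtain ⟨b, hb, hba⟩ : ∃ b ∈ s.filter fun v => k v = k a, b ≠ a := by
      apply Finset.exists_mem_ne
      have h0 : 0 < (s.filter fun v => k v = k a).card := Finset.card_pos.2 ⟨a, ha'⟩
      have := heven (k a)
      rcases this with ⟨r, hr⟩
      omega
    simp only [Finset.mem_filter] at hb
    obtain ⟨hbs, hkb⟩ := hb
    obtain ⟨s', hs'⟩ : ∃ s', s' = (s.erase a).erase b := ⟨_, rfl⟩
    have hbs' : b ∈ s.erase a := Finset.mem_erase.2 ⟨hba, hbs⟩
    have hcard : s'.card + 2 = s.card := by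
      have h1 := Finset.card_erase_add_one hbs'
      have h2 := Finset.card_erase_add_one ha
      rw [← hs'] at h1
      omega
    have hmem : ∀ v, v ∈ s' ↔ v ≠ b ∧ v ≠ a ∧ v ∈ s := by
      intro v; simp [hs', Finset.mem_erase]
    obtain ⟨g, hg1, hg2, hg3, hg4⟩ := ih s'.card (by omega) s' rfl (by
      intro c
      by_cases hc : k a = c
      · have : s'.filter (fun v => k v = c) = ((s.filter fun v => k v = c).erase a).erase b := by
          ext v; simp only [Finset.mem_filter, hmem, Finset.mem_erase]; tauto
        rw [this]
        have h1 : b ∈ (s.filter fun v => k v = c).erase a := by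
          simp [hba, hbs, hkb, hc]
        have h2 : a ∈ s.filter fun v => k v = c := by simp [ha, hc]
        have h3 := Finset.card_erase_add_one h1
        have h4 := Finset.card_erase_add_one h2
        obtain ⟨r, hr⟩ := heven c
        exact ⟨r - 1, by omega⟩
      · have : s'.filter (fun v => k v = c) = s.filter fun v => k v = c := by
          ext v
          simp only [Finset.mem_filter, hmem]
          constructor
          · tauto
          · rintro ⟨h1, h2⟩
            refine ⟨⟨?_, ?_, h1⟩, h2⟩
            · rintro rfl; exact hc (hkb ▸ h2)
            · rintro rfl; exact hc h2
        rw [this]; exact heven c)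
    refine ⟨fun v => if v = a ∨ v = b then a else g v, ?_, ?_, ?_, ?_⟩
    · intro v hv
      dsimp only
      split_ifs with h
      · exact ha
      · push Not at h
        exact ((hmem _).1 (hg1 v ((hmem v).2 ⟨h.2, h.1, hv⟩))).2.2
    · intro v hv w hw
      have h1 : ∀ z ∈ s, ¬ (z = a ∨ z = b) → z ∈ s' ∧ g z ≠ a := by
        intro z hz h
        push Not at h
        have h2 : z ∈ s' := (hmem z).2 ⟨h.2, h.1, hz⟩
        exact ⟨h2, ((hmem _).1 (hg1 z h2)).2.1⟩
      have e1 := h1 v hv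
      have e2 := h1 w hw
      have e3 := hg2 v
      clear ih heven hs' hmem hg1 hg2 hg3 hg4 h1 hcard ha' hbs'
      grind
    · intro v hv w hw z hz
      simp only [Finset.mem_coe] at hv hw hz
      have h1 : ∀ z ∈ s, ¬ (z = a ∨ z = b) → z ∈ s' ∧ g z ≠ a := by
        intro z hz h
        push Not at h
        have h2 : z ∈ s' := (hmem z).2 ⟨h.2, h.1, hz⟩
        exact ⟨h2, ((hmem _).1 (hg1 z h2)).2.1⟩
      have e1 := h1 v hv
      have e2 := h1 w hw
      have e3 := h1 z hz
      have e4 := hg3 v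
      simp only [Finset.mem_coe] at e4
      have e5 := fun h => e4 h w
      have e6 := fun h h' => e5 h h' z
      clear ih heven hs' hmem hg1 hg2 hg3 hg4 h1 hcard ha' hbs' e4 e5
      dsimp only
      by_cases c1 : v = a ∨ v = b <;> by_cases c2 : w = a ∨ w = b <;>
        by_cases c3 : z = a ∨ z = b <;> simp only [c1, c2, c3, if_true, if_false] <;> grind
    · have : s.image (fun v => if v = a ∨ v = b then a else g v) = insert a (s'.image g) := by
        ext v
        simp only [Finset.mem_image, Finset.mem_insert]
        constructor
        · rintro ⟨w, hw, rfl⟩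
          split_ifs with h
          · exact Or.inl rfl
          · push Not at h
            exact Or.inr ⟨w, (hmem w).2 ⟨h.2, h.1, hw⟩, rfl⟩
        · rintro (rfl | ⟨w, hw, rfl⟩)
          · exact ⟨v, ha, by simp⟩
          · have := (hmem w).1 hw
            exact ⟨w, this.2.2, by simp [this.1, this.2.1]⟩
      rw [this, Finset.card_insert_of_notMem]
      · omega
      · simp only [Finset.mem_image, not_exists, not_and]
        intro w hw h
        exact ((hmem _).1 (hg1 w hw)).2.1 h

variable [Fintype V]

lemma card_image_glue_le (g : V → V) (x y : V) :
    (Finset.univ.image (glue g x y)).card ≤ (Finset.univ.image g).card := by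
  apply Finset.card_le_card
  intro v
  simp only [Finset.mem_image, Finset.mem_univ, true_and, glue]
  rintro ⟨a, rfl⟩
  split_ifs
  · exact ⟨x, rfl⟩
  · exact ⟨a, rfl⟩

lemma card_image_glue_lt {g : V → V} {x y : V} (h : g x ≠ g y) :
    (Finset.univ.image (glue g x y)).card < (Finset.univ.image g).card := by
  apply Finset.card_lt_card
  refine Finset.ssubset_iff_of_subset ?_ |>.2 ⟨g y, by simp, ?_⟩
  · intro v
    simp only [Finset.mem_image, Finset.mem_univ, true_and, glue]
    rintro ⟨a, rfl⟩
    split_ifs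
    · exact ⟨x, rfl⟩
    · exact ⟨a, rfl⟩
  · simp only [Finset.mem_image, Finset.mem_univ, true_and, glue, not_exists]
    intro a
    split_ifs with h1
    · exact h
    · exact h1

/-- Matching the points `p j` and `q j` by a uniformly random permutation, when all points not yet
matched lie at most two in a class: an expected value of `c ^ #classes`. -/
lemma sum_perm_le {c : ℝ} (hc : 1 ≤ c) (N : ℕ) :
    ∀ (p q : Fin N → V) (g : V → V) (W : Set V) (Ψ : Equiv.Perm (Fin N) → ℝ)
      (Q : Equiv.Perm (Fin N) → (V → V) → Prop) (D : ℝ), 0 ≤ D →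
      Function.Injective p → Function.Injective q → (∀ i j, p i ≠ q j) →
      (∀ i, p i ∉ W) → (∀ i, q i ∉ W) →
      AtMostTwo g (W ∪ Set.range p ∪ Set.range q) →
      (∀ π, Q π g) → (∀ π g' j, Q π g' → Q π (glue g' (p j) (q (π j)))) →
      (∀ π g', Q π g' → AtMostTwo g' W → Ψ π ≤ D * c ^ (Finset.univ.image g').card) →
      ∑ π, Ψ π ≤ D * (∏ j ∈ Finset.range N, (c + j) / c) * c ^ (Finset.univ.image g).card := by
  have hc0 : 0 < c := by linarith
  induction N with
  | zero =>
    intro p q g W Ψ Q D hD hp hq hpq hpW hqW hg hQ hQ' hΨ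
    simp only [Finset.range_zero, Finset.prod_empty, mul_one]
    rw [Fintype.sum_unique]
    exact hΨ _ g (hQ _) (hg.mono (by intro v hv; simp [hv]))
  | succ N ih =>
    intro p q g W Ψ Q D hD hp hq hpq hpW hqW hg hQ hQ' hΨ
    -- Expose `π 0 = y` first; `σ` then matches the remaining points to the targets other than `q
    -- y`, relabelled by `Equiv.swap 0 y`. `Q π` is an invariant of the colouring along the
    -- exposure, and `W` holds the points reserved for later layers.
    have key : ∀ y : Fin (N + 1),
        ∑ σ : Equiv.Perm (Fin N), Ψ (Equiv.Perm.decomposeFin.symm (y, σ)) ≤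
          D * (∏ j ∈ Finset.range N, (c + j) / c) *
            c ^ (Finset.univ.image (glue g (p 0) (q y))).card := by
      intro y
      refine ih (fun j => p j.succ) (fun j => q (Equiv.swap 0 y j.succ)) (glue g (p 0) (q y)) W
        (fun σ => Ψ (Equiv.Perm.decomposeFin.symm (y, σ)))
        (fun σ => Q (Equiv.Perm.decomposeFin.symm (y, σ))) D hD
        (hp.comp (Fin.succ_injective _))
        (hq.comp ((Equiv.injective _).comp (Fin.succ_injective _)))
        (fun i j => hpq _ _) (fun i => hpW _) (fun i => hqW _) ?_ ?_ ?_ ?_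
      · refine (hg.glue (x := p 0) (y := q y) (by simp) (by simp) (hpq _ _)).mono ?_
        rintro v ((hv | ⟨j, rfl⟩) | ⟨j, rfl⟩)
        · refine ⟨by simp [hv], ?_⟩
          rintro (h | h)
          · exact hpW 0 (h ▸ hv)
          · exact hqW y (h ▸ hv)
        · refine ⟨by simp, ?_⟩
          rintro (h | h)
          · exact absurd (hp h) (Fin.succ_ne_zero _)
          · exact hpq _ _ h
        · refine ⟨by simp, ?_⟩
          rintro (h | h)
          · exact hpq _ _ h.symm
          · have h1 := hq h
            rw [Equiv.swap_apply_eq_iff, Equiv.swap_apply_right] at h1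
            exact absurd h1 (Fin.succ_ne_zero _)
      · intro σ
        have := hQ' (Equiv.Perm.decomposeFin.symm (y, σ)) g 0 (hQ _)
        simpa using this
      · intro σ g' j hg'
        have := hQ' (Equiv.Perm.decomposeFin.symm (y, σ)) g' j.succ hg'
        simpa using this
      · intro σ g' hg' hW
        exact hΨ _ g' hg' hW
    have hcount : ∑ y : Fin (N + 1), c ^ (Finset.univ.image (glue g (p 0) (q y))).card ≤
        (c + N) / c * c ^ (Finset.univ.image g).card := by
      have h1 : ∀ y : Fin (N + 1), c ^ (Finset.univ.image (glue g (p 0) (q y))).card ≤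
          (if g (p 0) = g (q y) then c else 1) * (c ^ (Finset.univ.image g).card / c) := by
        intro y
        split_ifs with h
        · rw [mul_div_cancel₀ _ hc0.ne']
          exact pow_le_pow_right₀ hc (card_image_glue_le _ _ _)
        · rw [one_mul, le_div_iff₀ hc0, ← pow_succ]
          exact pow_le_pow_right₀ hc (card_image_glue_lt h)
      -- Two targets with the colour of `p 0` would make three points of one colour, so at most one
      -- `y` contributes `c`.
      have h2 : ∑ y : Fin (N + 1), (if g (p 0) = g (q y) then c else 1) ≤ c + N := by
        by_cases hex : ∃ y, g (p 0) = g (q y)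
        · obtain ⟨y, hy⟩ := hex
          rw [Fintype.sum_eq_add_sum_compl y, if_pos hy]
          have : ∑ z ∈ ({y} : Finset (Fin (N + 1)))ᶜ, (if g (p 0) = g (q z) then c else 1) =
              ∑ z ∈ ({y} : Finset (Fin (N + 1)))ᶜ, (1 : ℝ) := by
            refine Finset.sum_congr rfl fun z hz => if_neg fun hz' => ?_
            rcases hg (p 0) (by simp) (q y) (by simp) (q z) (by simp) hy hz' with h | h | h
            · exact hpq _ _ h
            · exact hpq _ _ h
            · simp only [Finset.mem_compl, Finset.mem_singleton] at hz
              exact hz (hq h).symm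
          rw [this, Finset.sum_const, Finset.card_compl, Finset.card_singleton, Fintype.card_fin]
          simp
        · push Not at hex
          rw [Finset.sum_congr rfl fun y _ => if_neg (hex y)]
          simp only [Finset.sum_const, Finset.card_univ, Fintype.card_fin, nsmul_eq_mul, mul_one]
          push_cast
          linarith
      calc _ ≤ ∑ y : Fin (N + 1),
            (if g (p 0) = g (q y) then c else 1) * (c ^ (Finset.univ.image g).card / c) :=
            Finset.sum_le_sum fun y _ => h1 y
        _ = (∑ y : Fin (N + 1), (if g (p 0) = g (q y) then c else 1)) *
            (c ^ (Finset.univ.image g).card / c) := by rw [Finset.sum_mul]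
        _ ≤ (c + N) * (c ^ (Finset.univ.image g).card / c) := by gcongr
        _ = _ := by ring
    rw [← Equiv.sum_comp Equiv.Perm.decomposeFin.symm, Fintype.sum_prod_type]
    calc _ ≤ ∑ y : Fin (N + 1), D * (∏ j ∈ Finset.range N, (c + j) / c) *
            c ^ (Finset.univ.image (glue g (p 0) (q y))).card :=
          Finset.sum_le_sum fun y _ => key y
      _ = D * (∏ j ∈ Finset.range N, (c + j) / c) *
          ∑ y : Fin (N + 1), c ^ (Finset.univ.image (glue g (p 0) (q y))).card := by
          rw [Finset.mul_sum]
      _ ≤ D * (∏ j ∈ Finset.range N, (c + j) / c) *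
          ((c + N) / c * c ^ (Finset.univ.image g).card) := by
          gcongr
      _ = _ := by rw [Finset.prod_range_succ]; ring

/-- The same with `l` independent layers of points. -/
lemma sum_perms_le {c : ℝ} (hc : 1 ≤ c) (N l : ℕ) :
    ∀ (p q : Fin l → Fin N → V) (g : V → V) (Ψ : (Fin l → Equiv.Perm (Fin N)) → ℝ)
      (Q : (Fin l → Equiv.Perm (Fin N)) → (V → V) → Prop),
      (∀ s i s' j, p s i = p s' j → s = s' ∧ i = j) →
      (∀ s i s' j, q s i = q s' j → s = s' ∧ i = j) →
      (∀ s i s' j, p s i ≠ q s' j) →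
      AtMostTwo g {v | ∃ s j, v = p s j ∨ v = q s j} →
      (∀ π, Q π g) → (∀ π g' s j, Q π g' → Q π (glue g' (p s j) (q s (π s j)))) →
      (∀ π g', Q π g' → Ψ π ≤ c ^ (Finset.univ.image g').card) →
      ∑ π, Ψ π ≤
        (∏ j ∈ Finset.range N, (c + j) / c) ^ l * c ^ (Finset.univ.image g).card := by
  have hc0 : 0 < c := by linarith
  have hprod : 0 ≤ ∏ j ∈ Finset.range N, (c + j) / c :=
    Finset.prod_nonneg fun j _ => by positivity
  induction l with
  | zero =>
    intro p q g Ψ Q _ _ _ _ hQ _ hΨ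
    rw [Fintype.sum_unique, pow_zero, one_mul]
    exact hΨ _ g (hQ _)
  | succ l ih =>
    intro p q g Ψ Q hp hq hpq hg hQ hQ' hΨ
    rw [← Equiv.sum_comp (Fin.consEquiv fun _ => Equiv.Perm (Fin N)), Fintype.sum_prod_type]
    -- Layer `0` is exposed with the sum over the other layers in the role of `Ψ`; the induction
    -- hypothesis bounds that sum, and its product becomes `D`.
    have := sum_perm_le hc N (p 0) (q 0) g {v | ∃ s : Fin l, ∃ j, v = p s.succ j ∨ v = q s.succ j}
      (fun π₀ => ∑ π : Fin l → Equiv.Perm (Fin N), Ψ (Fin.consEquiv (fun _ => Equiv.Perm (Fin N)) (π₀, π)))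
      (fun π₀ g' => ∀ π : Fin l → Equiv.Perm (Fin N), Q (Fin.consEquiv (fun _ => Equiv.Perm (Fin N)) (π₀, π)) g')
      ((∏ j ∈ Finset.range N, (c + j) / c) ^ l) (by positivity)
      (fun i j h => (hp _ _ _ _ h).2) (fun i j h => (hq _ _ _ _ h).2) (fun i j => hpq _ _ _ _)
      ?_ ?_ ?_ ?_ ?_ ?_
    · rwa [← pow_succ] at this
    · rintro i ⟨s, j, h | h⟩
      · exact absurd (hp _ _ _ _ h).1.symm (Fin.succ_ne_zero _)
      · exact hpq _ _ _ _ h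
    · rintro i ⟨s, j, h | h⟩
      · exact hpq _ _ _ _ h.symm
      · exact absurd (hq _ _ _ _ h).1.symm (Fin.succ_ne_zero _)
    · refine hg.mono ?_
      rintro v ((⟨s, j, h⟩ | ⟨j, rfl⟩) | ⟨j, rfl⟩)
      · exact ⟨s.succ, j, h⟩
      · exact ⟨0, j, Or.inl rfl⟩
      · exact ⟨0, j, Or.inr rfl⟩
    · intro π₀ π
      exact hQ _
    · intro π₀ g' j h π
      have := hQ' (Fin.consEquiv (fun _ => Equiv.Perm (Fin N)) (π₀, π)) g' 0 j (h π)
      simpa using this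
    · intro π₀ g' hg' hW
      refine ih (fun s => p s.succ) (fun s => q s.succ) g' _
        (fun π => Q (Fin.consEquiv (fun _ => Equiv.Perm (Fin N)) (π₀, π))) ?_ ?_ ?_ ?_ ?_ ?_ ?_
      · intro s i s' j h
        have := hp _ _ _ _ h
        exact ⟨Fin.succ_injective _ this.1, this.2⟩
      · intro s i s' j h
        have := hq _ _ _ _ h
        exact ⟨Fin.succ_injective _ this.1, this.2⟩
      · intro s i s' j
        exact hpq _ _ _ _
      · exact hW
      · exact hg'
      · intro π g'' s j h
        have := hQ' (Fin.consEquiv (fun _ => Equiv.Perm (Fin N)) (π₀, π)) g'' s.succ j h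
        simpa using this
      · intro π g'' h
        exact hΨ _ g'' h

end Exposure

/-! ### Slots, classes of slots, and the count of compatible walks -/

/-- A slot of the trace of a product of `l` matrices: a factor, a side (`false` for the row index,
`true` for the column index) and a coordinate of the index. -/
abbrev Slot (l t : ℕ) := Fin l × Bool × Fin (2 * t)

/-- The labels that the slots receive from the indices `x` of a closed walk, permuted by `π` on the
row side and by `π'` on the column side. -/
def slotLabel {d l t : ℕ} (x : Fin (l + 1) → Fin (2 * t) → Fin d)
    (π π' : Fin (l + 1) → Equiv.Perm (Fin (2 * t))) (a : Slot (l + 1) t) : Fin d :=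
  if a.2.1 then x (a.1 + 1) (π' a.1 a.2.2) else x a.1 (π a.1 a.2.2)

/-- A map to representatives of the fibres of `g`. -/
noncomputable def rep {V β : Type*} (g : V → β) (a : V) : V :=
  (Quotient.mk (Setoid.ker g) a).out

lemma apply_rep {V β : Type*} (g : V → β) (a : V) : g (rep g a) = g a := by
  have : (Setoid.ker g).r (rep g a) a := Quotient.exact (Quotient.out_eq _)
  exact this

lemma rep_eq_rep_iff {V β : Type*} (g : V → β) (a b : V) : rep g a = rep g b ↔ g a = g b := by
  constructor
  · intro h
    have := congrArg g h
    rwa [apply_rep g, apply_rep g] at this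
  · intro h
    unfold rep
    congr 1
    exact Quotient.sound h

lemma rep_rep {V β : Type*} (g : V → β) (a : V) : rep g (rep g a) = rep g a :=
  (rep_eq_rep_iff g _ _).2 (apply_rep g a)

/-- The representatives of the classes that contain a column slot preceding all row slots of the
class. -/
noncomputable def colFirst {l t : ℕ} (R : Slot l t → Slot l t) : Finset (Slot l t) :=
  letI := Classical.decPred fun r : Slot l t =>
    R r = r ∧ ∃ s p, R (s, true, p) = r ∧ ∀ s' p', R (s', false, p') = r → s < s'
  Finset.univ.filter fun r =>
    R r = r ∧ ∃ s p, R (s, true, p) = r ∧ ∀ s' p', R (s', false, p') = r → s < s'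

lemma mem_colFirst {l t : ℕ} (R : Slot l t → Slot l t) (r : Slot l t) :
    r ∈ colFirst R ↔
      R r = r ∧ ∃ s p, R (s, true, p) = r ∧ ∀ s' p', R (s', false, p') = r → s < s' := by
  simp [colFirst]

section Classes

variable {l t : ℕ} (R : Slot (l + 1) t → Slot (l + 1) t)
  (π π' : Fin (l + 1) → Equiv.Perm (Fin (2 * t)))

/-- The finest equivalence relation that is coarser than `R` and relates any two slots that read
the same coordinate of the walk. -/
def walkSetoid : Setoid (Slot (l + 1) t) :=
  sInf {S | (∀ a b, R a = R b → S a b) ∧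
    ∀ s p, S (s, false, p) (s - 1, true, (π' (s - 1)).symm (π s p))}

lemma walkSetoid_of_eq {a b : Slot (l + 1) t} (h : R a = R b) : walkSetoid R π π' a b :=
  fun _ hS => hS.1 a b h

lemma walkSetoid_link (s : Fin (l + 1)) (p : Fin (2 * t)) :
    walkSetoid R π π' (s, false, p) (s - 1, true, (π' (s - 1)).symm (π s p)) :=
  fun _ hS => hS.2 s p

lemma slotLabel_eq_of_walkSetoid {d : ℕ} {x : Fin (l + 1) → Fin (2 * t) → Fin d}
    (hx : ∀ a b, R a = R b → slotLabel x π π' a = slotLabel x π π' b)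
    {a b : Slot (l + 1) t} (h : walkSetoid R π π' a b) :
    slotLabel x π π' a = slotLabel x π π' b := by
  have hle : walkSetoid R π π' ≤ Setoid.ker (slotLabel x π π') := by
    refine sInf_le ⟨fun a b hab => hx a b hab, fun s p => ?_⟩
    change slotLabel x π π' _ = slotLabel x π π' _
    simp [slotLabel]
  exact hle h

lemma slotLabel_injective {d : ℕ} :
    Function.Injective fun x : Fin (l + 1) → Fin (2 * t) → Fin d => slotLabel x π π' := by
  intro x y h
  funext s p
  have := congrFun h (s, false, (π s).symm p)
  simpa [slotLabel] using this

/-- The slot labels of a compatible walk descend to the classes, and a walk is recovered from its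
slot labels. -/
lemma card_labels_le (d : ℕ) [DecidablePred fun x : Fin (l + 1) → Fin (2 * t) → Fin d =>
      ∀ a b, R a = R b → slotLabel x π π' a = slotLabel x π π' b] :
    (Finset.univ.filter fun x : Fin (l + 1) → Fin (2 * t) → Fin d =>
      ∀ a b, R a = R b → slotLabel x π π' a = slotLabel x π π' b).card ≤
      d ^ Nat.card (Quotient (walkSetoid R π π')) := by
  classical
  have h1 : d ^ Nat.card (Quotient (walkSetoid R π π')) =
      Nat.card (Quotient (walkSetoid R π π') → Fin d) := by
    simp
  rw [h1, ← Fintype.card_subtype, ← Nat.card_eq_fintype_card]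
  refine Nat.card_le_card_of_injective
    (fun x => Quotient.lift (slotLabel x.1 π π')
      fun a b h => slotLabel_eq_of_walkSetoid R π π' x.2 h) ?_
  intro x y h
  apply Subtype.ext
  apply slotLabel_injective π π'
  funext a
  exact congrFun h (Quotient.mk _ a)

/-- A class of `walkSetoid` without a slot in the first row contains a class of `R` whose column
slot comes first. -/
lemma card_walkSetoid_le (hR : ∀ a, R (R a) = R a) :
    Nat.card (Quotient (walkSetoid R π π')) ≤ 2 * t + (colFirst R).card := by
  classical
  -- Send a class to something that determines it: one of its slots in row `0` if there is one,
  -- otherwise the `R`-class of its earliest column slot. The latter is column-first, because a row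
  -- slot of a factor `s ≠ 0` is linked to a column slot of factor `s - 1`.
  have hkey : ∀ κ : Quotient (walkSetoid R π π'),
      ∃ y : Fin (2 * t) ⊕ colFirst R,
        Sum.elim (fun p => (Quotient.mk (walkSetoid R π π') (0, false, p) = κ))
          (fun r => Quotient.mk (walkSetoid R π π') r.1 = κ) y := by
    intro κ
    by_cases h0 : ∃ p, Quotient.mk (walkSetoid R π π') ((0 : Fin (l + 1)), false, p) = κ
    · obtain ⟨p, hp⟩ := h0
      exact ⟨Sum.inl p, hp⟩
    have hrow : ∀ s p, Quotient.mk (walkSetoid R π π') (s, false, p) = κ →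
        ∃ s' p', Quotient.mk (walkSetoid R π π') (s', true, p') = κ ∧ s' < s := by
      intro s p h
      refine ⟨s - 1, (π' (s - 1)).symm (π s p), ?_, ?_⟩
      · rw [← h]
        exact Quotient.sound (Setoid.symm' _ (walkSetoid_link R π π' s p))
      · have hs : s ≠ 0 := by
          rintro rfl
          exact h0 ⟨p, h⟩
        exact Fin.sub_one_lt_iff.2 (Fin.pos_iff_ne_zero.2 hs)
    have hex : ∃ s p, Quotient.mk (walkSetoid R π π') (s, true, p) = κ := by
      obtain ⟨⟨s, b, p⟩, rfl⟩ := Quotient.exists_rep κ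
      cases b
      · obtain ⟨s', p', h, -⟩ := hrow s p rfl
        exact ⟨s', p', h⟩
      · exact ⟨s, p, rfl⟩
    let T : Finset (Fin (l + 1)) := Finset.univ.filter fun s =>
      ∃ p, Quotient.mk (walkSetoid R π π') (s, true, p) = κ
    obtain ⟨s, hs, hmin⟩ := T.exists_min_image id (by
      obtain ⟨s, p, h⟩ := hex
      exact ⟨s, by simp only [T, Finset.mem_filter, Finset.mem_univ, true_and]; exact ⟨p, h⟩⟩)
    simp only [T, Finset.mem_filter, Finset.mem_univ, true_and, id] at hs hmin
    obtain ⟨p, hp⟩ := hs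
    have hmk : ∀ a, Quotient.mk (walkSetoid R π π') (R a) = Quotient.mk (walkSetoid R π π') a :=
      fun a => Quotient.sound (walkSetoid_of_eq R π π' (hR a))
    refine ⟨Sum.inr ⟨R (s, true, p), (mem_colFirst _ _).2 ⟨hR _, s, p, rfl, ?_⟩⟩, ?_⟩
    · intro s' p' h
      obtain ⟨s'', p'', h1, h2⟩ := hrow s' p' (by rw [← hmk, h, hmk, hp])
      exact lt_of_le_of_lt (hmin s'' ⟨p'', h1⟩) h2
    · simp only [Sum.elim_inr]
      rw [hmk, hp]
  choose f hf using hkey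
  have hinj : Function.Injective f := by
    intro κ κ' h
    have h1 := hf κ
    have h2 := hf κ'
    rw [← h] at h2
    rcases hfk : f κ with p | r
    · rw [hfk] at h1 h2
      exact h1.symm.trans h2
    · rw [hfk] at h1 h2
      exact h1.symm.trans h2
  have := Nat.card_le_card_of_injective f hinj
  simpa [Nat.card_eq_fintype_card] using this

/-- The power `t ^ (2 * t)`, which comes from the `2 * t` initial pairs per factor, cancels the
denominators and leaves `(2 * t)! * (3 * t - 1).choose (2 * t)`. -/
lemma prod_add_div (t : ℕ) (ht : 1 ≤ t) :
    (∏ j ∈ Finset.range (2 * t), ((t : ℝ) + j) / t) * (t : ℝ) ^ (2 * t) ≤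
      8 ^ t * (2 * t).factorial := by
  have ht0 : (t : ℝ) ≠ 0 := by positivity
  rw [Finset.prod_div_distrib, Finset.prod_const, Finset.card_range, div_mul_cancel₀ _ (by positivity)]
  have h1 : (∏ j ∈ Finset.range (2 * t), ((t : ℝ) + j)) = (t.ascFactorial (2 * t) : ℕ) := by
    rw [Nat.ascFactorial_eq_prod_range]
    push_cast
    rfl
  rw [h1, Nat.ascFactorial_eq_factorial_mul_choose']
  push_cast
  rw [mul_comm]
  gcongr
  have h2 : (t + 2 * t - 1).choose (2 * t) ≤ 2 ^ (3 * t) :=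
    (Nat.choose_le_two_pow _ _).trans (Nat.pow_le_pow_right (by norm_num) (by omega))
  calc ((t + 2 * t - 1).choose (2 * t) : ℝ) ≤ (2 ^ (3 * t) : ℕ) := by exact_mod_cast h2
    _ = 8 ^ t := by push_cast; rw [pow_mul]; norm_num

lemma sum_pow_card_walkSetoid_le (ht : 1 ≤ t)
    (heven : ∀ r, Even (Finset.univ.filter fun a => R a = r).card) :
    ∑ π : Fin (l + 1) → Equiv.Perm (Fin (2 * t)),
      (t : ℝ) ^ Nat.card (Quotient (walkSetoid R π π')) ≤
      (8 ^ t * (2 * t).factorial) ^ (l + 1) := by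
  classical
  obtain ⟨g, -, hg2, hg3, hg4⟩ := exists_pairing R _ Finset.univ rfl heven
  have h1t : (1 : ℝ) ≤ t := by exact_mod_cast ht
  have hcard : (Finset.univ.image g).card = 2 * t * (l + 1) := by
    have : (Finset.univ : Finset (Slot (l + 1) t)).card = 2 * (2 * t * (l + 1)) := by
      simp [Finset.card_univ]; ring
    omega
  -- The column slots of factor `s - 1` are listed by the coordinate that they read, so that
  -- matching `j` to `π s j` is exactly a link of `walkSetoid`. The invariant is that the colouring
  -- refines `walkSetoid`, which therefore has at most as many classes.
  have := sum_perms_le h1t (2 * t) (l + 1) (fun s j => ((s, false, j) : Slot (l + 1) t))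
    (fun s j => (s - 1, true, (π' (s - 1)).symm j)) g
    (fun π => (t : ℝ) ^ Nat.card (Quotient (walkSetoid R π π')))
    (fun π g' => ∀ a b, g' a = g' b → walkSetoid R π π' a b) ?_ ?_ ?_ ?_ ?_ ?_ ?_
  · refine this.trans ?_
    rw [hcard, pow_mul, ← mul_pow]
    exact pow_le_pow_left₀ (mul_nonneg (Finset.prod_nonneg fun j _ => by positivity)
      (by positivity)) (prod_add_div t ht) _
  · intro s i s' j h
    simpa using h
  · intro s i s' j h
    simp only [Prod.mk.injEq, true_and] at h
    obtain ⟨h1, h2⟩ := h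
    have h3 : s = s' := by simpa using h1
    subst h3
    exact ⟨rfl, by simpa using h2⟩
  · intro s i s' j h
    simp at h
  · exact hg3.mono (by simp)
  · intro π a b h
    exact walkSetoid_of_eq R π π' (hg2 a (by simp) b (by simp) h)
  · intro π g' s j h a b hab
    have hl := walkSetoid_link R π π' s j
    simp only [glue] at hab
    split_ifs at hab with c1 c2 c2
    · exact Setoid.trans' _ (h _ _ c1) (Setoid.symm' _ (h _ _ c2))
    · exact Setoid.trans' _ (h _ _ c1) (Setoid.trans' _ (Setoid.symm' _ hl) (h _ _ hab))
    · exact Setoid.trans' _ (h _ _ hab) (Setoid.trans' _ hl (Setoid.symm' _ (h _ _ c2)))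
    · exact h _ _ hab
  · intro π g' h
    refine pow_le_pow_right₀ h1t ?_
    have h1 : (Finset.univ.image g').card = Nat.card (Finset.univ.image g') :=
      (Nat.card_eq_card_toFinset _).trans (by simp) |>.symm
    rw [h1]
    have hex : ∀ v : (Finset.univ.image g'), ∃ a, g' a = v.1 := by
      rintro ⟨v, hv⟩
      simpa using hv
    choose f hf using hex
    refine Nat.card_le_card_of_surjective (fun v => Quotient.mk (walkSetoid R π π') (f v)) ?_
    intro κ
    obtain ⟨a, rfl⟩ := Quotient.exists_rep κ
    exact ⟨⟨g' a, by simp⟩, Quotient.sound (h _ _ (hf _))⟩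

/-- The number of pairs of a permutation and a compatible labelling. -/
lemma sum_card_labels_le {d : ℕ} (ht : 1 ≤ t) (htd : t ≤ d) (hR : ∀ a, R (R a) = R a)
    (heven : ∀ r, Even (Finset.univ.filter fun a => R a = r).card)
    [∀ π : Fin (l + 1) → Equiv.Perm (Fin (2 * t)),
      DecidablePred fun x : Fin (l + 1) → Fin (2 * t) → Fin d =>
        ∀ a b, R a = R b → slotLabel x π π' a = slotLabel x π π' b] :
    ∑ π : Fin (l + 1) → Equiv.Perm (Fin (2 * t)),
      ((Finset.univ.filter fun x : Fin (l + 1) → Fin (2 * t) → Fin d =>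
        ∀ a b, R a = R b → slotLabel x π π' a = slotLabel x π π' b).card : ℝ) ≤
      ((d : ℝ) / t) ^ (2 * t + (colFirst R).card) * (8 ^ t * (2 * t).factorial) ^ (l + 1) := by
  have ht0 : (0 : ℝ) < t := by exact_mod_cast ht
  have hdt : 1 ≤ (d : ℝ) / t := by
    rw [le_div_iff₀ ht0, one_mul]
    exact_mod_cast htd
  -- Of `d ^ κ = (d / t) ^ κ * t ^ κ`, the first power is bounded for every `π` (using `1 ≤ d / t`),
  -- the second only on average.
  calc _ ≤ ∑ π : Fin (l + 1) → Equiv.Perm (Fin (2 * t)),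
        ((d : ℝ) / t) ^ (2 * t + (colFirst R).card) *
          (t : ℝ) ^ Nat.card (Quotient (walkSetoid R π π')) := by
        refine Finset.sum_le_sum fun π _ => ?_
        calc _ ≤ ((d ^ Nat.card (Quotient (walkSetoid R π π')) : ℕ) : ℝ) := by
              exact_mod_cast card_labels_le R π π' d
          _ = ((d : ℝ) / t) ^ Nat.card (Quotient (walkSetoid R π π')) *
              (t : ℝ) ^ Nat.card (Quotient (walkSetoid R π π')) := by
              rw [← mul_pow, div_mul_cancel₀ _ ht0.ne']; push_cast; rfl
          _ ≤ _ := by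
              gcongr
              exact card_walkSetoid_le R π π' hR
    _ ≤ _ := by
        rw [← Finset.mul_sum]
        gcongr
        exact sum_pow_card_walkSetoid_le R π' ht heven

end Classes

/-! ### Moments of products of independent entries -/

section Moments

variable {Ω : Type*} [MeasurableSpace Ω] {P : Measure Ω}

variable {V : Type*} [Fintype V] {n d : ℕ}

/-- The multiplicity of the entry `p` in a product of entries. -/
def multiplicity (F : V → Fin n) (Y : V → Fin d) (p : Fin n × Fin d) : ℕ :=
  (Finset.univ.filter fun a => (F a, Y a) = p).card

lemma prod_eq_prod_pow_multiplicity (F : V → Fin n) (Y : V → Fin d) (A : Fin n → Fin d → ℝ) :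
    ∏ a, A (F a) (Y a) = ∏ p : Fin n × Fin d, A p.1 p.2 ^ multiplicity F Y p := by
  rw [← Finset.prod_fiberwise' Finset.univ (fun a => (F a, Y a)) fun p => A p.1 p.2]
  refine Finset.prod_congr rfl fun p _ => ?_
  rw [Finset.prod_const, multiplicity]

variable {A : Fin n → Fin d → Ω → ℝ}

lemma integral_prod_eq (hA : ∀ i j, Measurable (A i j))
    (hind : iIndepFun (fun p : Fin n × Fin d => A p.1 p.2) P) (F : V → Fin n) (Y : V → Fin d) :
    ∫ ω, ∏ a, A (F a) (Y a) ω ∂P =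
      ∏ p : Fin n × Fin d, ∫ ω, A p.1 p.2 ω ^ multiplicity F Y p ∂P := by
  have h1 : ∀ ω, ∏ a, A (F a) (Y a) ω =
      ∏ p : Fin n × Fin d, A p.1 p.2 ω ^ multiplicity F Y p :=
    fun ω => prod_eq_prod_pow_multiplicity F Y fun i j => A i j ω
  simp_rw [h1]
  exact hind.integral_fun_prod_comp (f := fun p x => x ^ multiplicity F Y p)
    (fun p => (hA _ _).aemeasurable) fun p => (measurable_id.pow_const _).aestronglyMeasurable

lemma integral_prod_eq_zero (hA : ∀ i j, Measurable (A i j))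
    (hind : iIndepFun (fun p : Fin n × Fin d => A p.1 p.2) P)
    (hodd : ∀ i j (k : ℕ), Odd k → ∫ ω, A i j ω ^ k ∂P = 0) (F : V → Fin n) (Y : V → Fin d)
    {p : Fin n × Fin d} (hp : ¬ Even (multiplicity F Y p)) :
    ∫ ω, ∏ a, A (F a) (Y a) ω ∂P = 0 := by
  rw [integral_prod_eq hA hind]
  exact Finset.prod_eq_zero (Finset.mem_univ p) (hodd _ _ _ (Nat.not_even_iff_odd.1 hp))

variable [IsProbabilityMeasure P]

lemma integrable_pow_of_sq_le {X : Ω → ℝ} (hX : Measurable X) {B : ℝ}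
    (hb : ∀ᵐ ω ∂P, X ω ^ 2 ≤ B) (k : ℕ) : Integrable (fun ω => X ω ^ k) P := by
  refine Integrable.of_bound (hX.pow_const k).aestronglyMeasurable (Real.sqrt B ^ k) ?_
  filter_upwards [hb] with ω hω
  rw [norm_pow, Real.norm_eq_abs]
  exact pow_le_pow_left₀ (abs_nonneg _) (Real.abs_le_sqrt hω) k

lemma integral_pow_add_le {X : Ω → ℝ} (hX : Measurable X) {B : ℝ}
    (hb : ∀ᵐ ω ∂P, X ω ^ 2 ≤ B) (k q : ℕ) (hk : Even k) :
    ∫ ω, X ω ^ (k + 2 * q) ∂P ≤ B ^ q * ∫ ω, X ω ^ k ∂P := by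
  rw [← integral_const_mul]
  refine integral_mono_ae (integrable_pow_of_sq_le hX hb _)
    ((integrable_pow_of_sq_le hX hb _).const_mul _) ?_
  filter_upwards [hb] with ω hω
  rw [pow_add, pow_mul, mul_comm]
  exact mul_le_mul_of_nonneg_right (pow_le_pow_left₀ (sq_nonneg _) hω q) (hk.pow_nonneg _)

/-- The product of the moments of order `2 * q j`, in terms of the total excess over two. -/
lemma prod_moment_le {X : Fin d → Ω → ℝ} (hX : ∀ j, Measurable (X j)) {B μ₄ : ℝ}
    (hB : 1 ≤ B) (hμ : 1 ≤ μ₄) (hb : ∀ j, ∀ᵐ ω ∂P, X j ω ^ 2 ≤ B)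
    (h2 : ∀ j, ∫ ω, X j ω ^ 2 ∂P ≤ 1) (h4 : ∀ j, ∫ ω, X j ω ^ 4 ∂P ≤ μ₄) (q : Fin d → ℕ) :
    ∏ j, ∫ ω, X j ω ^ (2 * q j) ∂P ≤
      μ₄ * B ^ (∑ j, q j - (Finset.univ.filter fun j => q j ≠ 0).card - 1) := by
  have hB0 : (0 : ℝ) ≤ B := by linarith
  have hnn : ∀ j, 0 ≤ ∫ ω, X j ω ^ (2 * q j) ∂P := fun j =>
    integral_nonneg fun ω => (even_two_mul _).pow_nonneg _
  have hle : ∀ j, ∫ ω, X j ω ^ (2 * q j) ∂P ≤ B ^ (q j - 1) := by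
    intro j
    rcases Nat.eq_zero_or_pos (q j) with h | h
    · simp [h]
    · have := integral_pow_add_le (hX j) (hb j) 2 (q j - 1) even_two
      rw [show 2 + 2 * (q j - 1) = 2 * q j by omega] at this
      calc _ ≤ _ := this
        _ ≤ B ^ (q j - 1) * 1 := by gcongr; exact h2 j
        _ = _ := mul_one _
  have hsum : ∑ j, q j - (Finset.univ.filter fun j => q j ≠ 0).card = ∑ j, (q j - 1) := by
    have : ∑ j, q j = ∑ j, (q j - 1) + (Finset.univ.filter fun j => q j ≠ 0).card := by
      rw [Finset.card_filter, ← Finset.sum_add_distrib]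
      refine Finset.sum_congr rfl fun j _ => ?_
      split_ifs with h
      · omega
      · omega
    omega
  rw [hsum]
  -- With no excess over two the truncated exponent is `0` and `1 ≤ μ₄` suffices. Otherwise some
  -- moment has order at least four; bounding it through `μ₄` saves one power of `B`.
  by_cases hall : ∀ j, q j ≤ 1
  · calc _ ≤ ∏ j, B ^ (q j - 1) := Finset.prod_le_prod (fun j _ => hnn j) fun j _ => hle j
      _ = 1 := Finset.prod_eq_one fun j _ => by rw [Nat.sub_eq_zero_of_le (hall j), pow_zero]
      _ = 1 * 1 := (mul_one _).symm
      _ ≤ _ := mul_le_mul hμ (one_le_pow₀ hB) zero_le_one (by linarith)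
  · push Not at hall
    obtain ⟨j, hj⟩ := hall
    rw [← Finset.mul_prod_erase _ _ (Finset.mem_univ j),
      ← Finset.add_sum_erase _ _ (Finset.mem_univ j)]
    have h1 : ∫ ω, X j ω ^ (2 * q j) ∂P ≤ B ^ (q j - 2) * μ₄ := by
      have := integral_pow_add_le (hX j) (hb j) 4 (q j - 2) (by decide)
      rw [show 4 + 2 * (q j - 2) = 2 * q j by omega] at this
      refine this.trans ?_
      gcongr
      exact h4 j
    have h3 : ∏ i ∈ Finset.univ.erase j, ∫ ω, X i ω ^ (2 * q i) ∂P ≤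
        B ^ ∑ i ∈ Finset.univ.erase j, (q i - 1) := by
      rw [← Finset.prod_pow_eq_pow_sum]
      exact Finset.prod_le_prod (fun j _ => hnn j) fun j _ => hle j
    calc _ ≤ (B ^ (q j - 2) * μ₄) * B ^ ∑ i ∈ Finset.univ.erase j, (q i - 1) :=
          mul_le_mul h1 h3 (Finset.prod_nonneg fun j _ => hnn j) (by positivity)
      _ = μ₄ * B ^ ((q j - 2) + ∑ i ∈ Finset.univ.erase j, (q i - 1)) := by
          rw [pow_add]; ring
      _ = _ := by
          congr 2
          omega

lemma integral_prod_le (hA : ∀ i j, Measurable (A i j))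
    (hind : iIndepFun (fun p : Fin n × Fin d => A p.1 p.2) P) {B μ₄ : ℝ}
    (hB : 1 ≤ B) (hμ : 1 ≤ μ₄) (hb : ∀ i j, ∀ᵐ ω ∂P, A i j ω ^ 2 ≤ B)
    (h2 : ∀ i j, ∫ ω, A i j ω ^ 2 ∂P ≤ 1) (h4 : ∀ i j, ∫ ω, A i j ω ^ 4 ∂P ≤ μ₄)
    (F : V → Fin n) (Y : V → Fin d) (heven : ∀ p, Even (multiplicity F Y p)) :
    ∫ ω, ∏ a, A (F a) (Y a) ω ∂P ≤ ∏ i ∈ Finset.univ.image F,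
      μ₄ * B ^ ((Finset.univ.filter fun a => F a = i).card / 2 -
        ((Finset.univ.filter fun a => F a = i).image Y).card - 1) := by
  classical
  rw [integral_prod_eq hA hind, Fintype.prod_prod_type,
    ← Finset.prod_subset (Finset.subset_univ (Finset.univ.image F))]
  · refine Finset.prod_le_prod (fun i _ => Finset.prod_nonneg fun j _ =>
      integral_nonneg fun ω => (heven _).pow_nonneg _) fun i _ => ?_
    choose q hq using fun j => (heven (i, j)).two_dvd
    simp_rw [hq]
    refine (prod_moment_le (hA i) hB hμ (hb i) (h2 i) (h4 i) q).trans (le_of_eq ?_)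
    congr 3
    · have h1 : (Finset.univ.filter fun a => F a = i).card = ∑ j, multiplicity F Y (i, j) := by
        rw [Finset.card_eq_sum_card_fiberwise (f := Y) (t := Finset.univ) (by simp)]
        refine Finset.sum_congr rfl fun j _ => ?_
        rw [multiplicity, Finset.filter_filter]
        simp only [Prod.mk.injEq]
      have h3 : (Finset.univ.filter fun a => F a = i).card / 2 = ∑ j, q j := by
        rw [h1, Finset.sum_congr rfl fun j _ => hq j, ← Finset.mul_sum]
        omega
      rw [h3]
      congr 2
      ext j
      simp only [Finset.mem_filter, Finset.mem_univ, true_and, Finset.mem_image]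
      have h4 : q j ≠ 0 ↔ multiplicity F Y (i, j) ≠ 0 := by rw [hq]; omega
      rw [h4, multiplicity, Finset.card_ne_zero]
      simp only [Finset.Nonempty, Finset.mem_filter, Finset.mem_univ, true_and, Prod.mk.injEq]
  · intro i _ hi
    refine Finset.prod_eq_one fun j _ => ?_
    have : multiplicity F Y (i, j) = 0 := by
      rw [multiplicity, Finset.card_eq_zero, Finset.filter_eq_empty_iff]
      intro a _ h
      exact hi (Finset.mem_image.2 ⟨a, Finset.mem_univ _, congrArg Prod.fst h⟩)
    simp [this]

lemma integrable_prod (hA : ∀ i j, Measurable (A i j)) {B : ℝ}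
    (hb : ∀ i j, ∀ᵐ ω ∂P, A i j ω ^ 2 ≤ B) (F : V → Fin n) (Y : V → Fin d) :
    Integrable (fun ω => ∏ a, A (F a) (Y a) ω) P := by
  refine Integrable.of_bound
    (Finset.measurable_prod _ fun a _ => hA _ _).aestronglyMeasurable
    (∏ _a : V, Real.sqrt B) ?_
  have : ∀ᵐ ω ∂P, ∀ i j, A i j ω ^ 2 ≤ B := by
    rw [ae_all_iff]; intro i
    rw [ae_all_iff]; intro j
    exact hb i j
  filter_upwards [this] with ω hω
  rw [norm_prod]
  exact Finset.prod_le_prod (fun _ _ => norm_nonneg _) fun a _ => Real.abs_le_sqrt (hω _ _)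

end Moments

/-! ### Class counts of a single vector -/

/-- The coordinates `2 * k` and `2 * k + 1` of an index, for the `k`-th pair. -/
def pairPos {t : ℕ} (k : Fin t) (b : Bool) : Fin (2 * t) :=
  if b then ⟨2 * k.1 + 1, by omega⟩ else ⟨2 * k.1, by omega⟩

/-- The pair to which a coordinate belongs. -/
def half {t : ℕ} (p : Fin (2 * t)) : Fin t := ⟨p.1 / 2, by omega⟩

@[simp] lemma half_pairPos {t : ℕ} (k : Fin t) (b : Bool) : half (pairPos k b) = k := by
  apply Fin.ext
  cases b <;> simp [half, pairPos]
  omega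

/-- Coordinates as pairs of a pair number and a position in the pair. -/
def pairPosEquiv (t : ℕ) : Fin t × Bool ≃ Fin (2 * t) where
  toFun x := pairPos x.1 x.2
  invFun p := (half p, decide (p.1 % 2 = 1))
  left_inv x := by
    refine Prod.ext (half_pairPos _ _) ?_
    rcases x with ⟨k, b⟩
    cases b <;> simp [pairPos, Nat.add_mod]
  right_inv p := by
    apply Fin.ext
    rcases Nat.mod_two_eq_zero_or_one p.1 with h | h <;> simp [pairPos, half, h] <;> omega

lemma prod_eq_prod_pairPos {M : Type*} [CommMonoid M] {t : ℕ} (g : Fin (2 * t) → M) :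
    ∏ p, g p = ∏ k : Fin t, g (pairPos k false) * g (pairPos k true) := by
  rw [← (pairPosEquiv t).prod_comp, Fintype.prod_prod_type]
  refine Finset.prod_congr rfl fun k _ => ?_
  rw [Fintype.prod_bool, mul_comm]
  rfl

lemma sum_eq_sum_pairPos {M : Type*} [AddCommMonoid M] {t : ℕ} (g : Fin (2 * t) → M) :
    ∑ p, g p = ∑ k : Fin t, (g (pairPos k false) + g (pairPos k true)) := by
  rw [← (pairPosEquiv t).sum_comp, Fintype.sum_prod_type]
  refine Finset.sum_congr rfl fun k _ => ?_
  rw [Fintype.sum_bool, add_comm]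
  rfl

/-- The vector that is read in a slot, when the `k`-th vector of the `s`-th factor is `f s k`. -/
def slotVector {l t n : ℕ} (f : Fin l → Fin t → Fin n) (a : Slot l t) : Fin n :=
  f a.1 (half a.2.2)

section Local

variable {l t n d : ℕ} (f : Fin l → Fin t → Fin n)

/-- The number of factors in which the vector `i` occurs. -/
def occurrences (i : Fin n) : ℕ := (Finset.univ.filter fun s => ∃ k, f s k = i).card

/-- By injectivity a factor containing `i` has exactly one block for it, with two row and two column
slots. -/
lemma card_slotVector (hf : ∀ s, Function.Injective (f s)) (i : Fin n) :
    (Finset.univ.filter fun a => slotVector f a = i).card = 4 * occurrences f i := by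
  rw [occurrences, Finset.card_filter, Finset.card_filter, Fintype.sum_prod_type, Finset.mul_sum]
  refine Finset.sum_congr rfl fun s _ => ?_
  rw [Fintype.sum_prod_type, Fintype.sum_bool]
  simp only [slotVector, sum_eq_sum_pairPos, half_pairPos]
  split_ifs with h
  · obtain ⟨k, rfl⟩ := h
    have : ∀ k', (if f s k' = f s k then 1 else 0) + (if f s k' = f s k then 1 else 0) =
        if k = k' then 2 else 0 := by
      intro k'
      by_cases h : k = k'
      · simp [h]
      · have : f s k' ≠ f s k := fun h' => h (hf s h').symm
        simp [h, this]
    simp_rw [this]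
    simp
  · push Not at h
    simp [h]

variable (Y : Slot l t → Fin d)

lemma card_image_label (i : Fin n) :
    ((Finset.univ.filter fun a => slotVector f a = i).image Y).card =
      (Finset.univ.filter fun a =>
        slotVector f a = i ∧ rep (fun a => (slotVector f a, Y a)) a = a).card := by
  set R := rep fun a => (slotVector f a, Y a) with hR
  have hRa : ∀ a, slotVector f (R a) = slotVector f a ∧ Y (R a) = Y a := by
    intro a
    have := apply_rep (fun a => (slotVector f a, Y a)) a
    exact ⟨congrArg Prod.fst this, congrArg Prod.snd this⟩
  rw [← Finset.card_image_of_injOn (f := Y)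
    (s := Finset.univ.filter fun a => slotVector f a = i ∧ R a = a)]
  · congr 1
    ext j
    simp only [Finset.mem_image, Finset.mem_filter, Finset.mem_univ, true_and]
    constructor
    · rintro ⟨a, h1, h2⟩
      exact ⟨R a, ⟨(hRa a).1.trans h1, rep_rep _ _⟩, (hRa a).2.trans h2⟩
    · rintro ⟨a, ⟨h1, -⟩, h2⟩
      exact ⟨a, h1, h2⟩
  · intro a ha b hb h
    simp only [Finset.coe_filter, Finset.mem_univ, true_and, Set.mem_ofPred_eq] at ha hb
    rw [← ha.2, ← hb.2]
    exact (rep_eq_rep_iff _ _ _).2 (Prod.ext (ha.1.trans hb.1.symm) h)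

lemma sum_multiplicity (i : Fin n) :
    ∑ j ∈ (Finset.univ.filter fun a => slotVector f a = i).image Y,
      multiplicity (slotVector f) Y (i, j) =
      (Finset.univ.filter fun a => slotVector f a = i).card := by
  rw [Finset.card_eq_sum_card_image Y]
  refine Finset.sum_congr rfl fun j _ => ?_
  rw [multiplicity, Finset.filter_filter]
  simp only [Prod.mk.injEq]

/-- The number of classes of a vector, and of those whose column slots come first. -/
lemma colFirst_add_le (hf : ∀ s, Function.Injective (f s))
    (heven : ∀ p, Even (multiplicity (slotVector f) Y p))
    (hshift : ∀ s k, Y (s, false, pairPos k false) = Y (s, false, pairPos k true) →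
      ∃ b, Y (s, true, pairPos k b) = Y (s, false, pairPos k false))
    (i : Fin n) (hi : i ∈ Finset.univ.image (slotVector f)) :
    (((colFirst (rep fun a => (slotVector f a, Y a))).filter fun r => slotVector f r = i).card + 2 ≤
        (Finset.univ.filter fun a =>
          slotVector f a = i ∧ rep (fun a => (slotVector f a, Y a)) a = a).card ∧
      (Finset.univ.filter fun a =>
          slotVector f a = i ∧ rep (fun a => (slotVector f a, Y a)) a = a).card ≤
        2 * occurrences f i) ∨
    (((colFirst (rep fun a => (slotVector f a, Y a))).filter fun r => slotVector f r = i).card + 1 ≤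
        (Finset.univ.filter fun a =>
          slotVector f a = i ∧ rep (fun a => (slotVector f a, Y a)) a = a).card ∧
      (Finset.univ.filter fun a =>
          slotVector f a = i ∧ rep (fun a => (slotVector f a, Y a)) a = a).card + 1 ≤
        2 * occurrences f i) := by
  classical
  have hcard := card_image_label f Y i
  have hsum := sum_multiplicity f Y i
  rw [card_slotVector f hf] at hsum
  set R := rep fun a => (slotVector f a, Y a) with hR
  set I := (Finset.univ.filter fun a => slotVector f a = i).image Y with hI
  set K := Finset.univ.filter fun a => slotVector f a = i ∧ R a = a with hK
  set U := (colFirst R).filter fun r => slotVector f r = i with hU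
  have hRa : ∀ a, slotVector f (R a) = slotVector f a ∧ Y (R a) = Y a := by
    intro a
    have := apply_rep (fun a => (slotVector f a, Y a)) a
    exact ⟨congrArg Prod.fst this, congrArg Prod.snd this⟩
  have hmult : ∀ j ∈ I, 2 ≤ multiplicity (slotVector f) Y (i, j) := by
    intro j hj
    simp only [hI, Finset.mem_image, Finset.mem_filter, Finset.mem_univ, true_and] at hj
    obtain ⟨a, h1, h2⟩ := hj
    have : 0 < multiplicity (slotVector f) Y (i, j) :=
      Finset.card_pos.2 ⟨a, by simp [h1, h2]⟩
    have := heven (i, j)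
    rcases this with ⟨r, hr⟩
    omega
  have hk : K.card ≤ 2 * occurrences f i := by
    have := Finset.card_nsmul_le_sum I _ 2 hmult
    rw [hsum, smul_eq_mul] at this
    omega
  have hUK : U ⊆ K := by
    intro r hr
    simp only [hU, hK, Finset.mem_filter, mem_colFirst, Finset.mem_univ, true_and] at hr ⊢
    exact ⟨hr.2, hr.1.1⟩
  obtain ⟨s₀, hs₀, hmin⟩ : ∃ s, (∃ k, f s k = i) ∧ ∀ s', (∃ k, f s' k = i) → s ≤ s' := by
    obtain ⟨a, -, ha⟩ := Finset.mem_image.1 hi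
    let T := Finset.univ.filter fun s => ∃ k, f s k = i
    obtain ⟨s, hs, hmin⟩ := T.exists_min_image id ⟨a.1, by simp only [T, Finset.mem_filter, Finset.mem_univ, true_and]; exact ⟨_, ha⟩⟩
    simp only [T, Finset.mem_filter, Finset.mem_univ, true_and, id] at hs hmin
    exact ⟨s, hs, hmin⟩
  obtain ⟨k₀, hk₀⟩ := hs₀
  -- No column slot of `i` lies in a factor before `s₀`, so the classes of these two row slots are
  -- not column-first.
  have hrow : ∀ b, R (s₀, false, pairPos k₀ b) ∈ K \ U := by
    intro b
    have hF : slotVector f (s₀, false, pairPos k₀ b) = i := by simp [slotVector, hk₀]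
    rw [Finset.mem_sdiff]
    refine ⟨?_, ?_⟩
    · simp only [hK, Finset.mem_filter, Finset.mem_univ, true_and]
      exact ⟨(hRa _).1.trans hF, rep_rep _ _⟩
    · simp only [hU, Finset.mem_filter, mem_colFirst, not_and]
      rintro ⟨-, s, p, h1, h2⟩
      have h3 := h2 s₀ _ rfl
      have h4 : slotVector f (s, true, p) = i := by
        rw [← (hRa _).1, h1, (hRa _).1, hF]
      exact absurd (hmin s ⟨_, h4⟩) (not_le.2 h3)
  have hsd := Finset.card_sdiff_add_card_eq_card hUK
  -- Equal labels yield only one such class, but then `hshift` gives three slots with this label and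
  -- parity a fourth, which lowers the maximal number of classes by one.
  by_cases hY : Y (s₀, false, pairPos k₀ false) = Y (s₀, false, pairPos k₀ true)
  · right
    have h1 : 0 < (K \ U).card := Finset.card_pos.2 ⟨_, hrow false⟩
    refine ⟨by omega, ?_⟩
    obtain ⟨b, hb⟩ := hshift s₀ k₀ hY
    set j := Y (s₀, false, pairPos k₀ false) with hj
    have hj4 : 4 ≤ multiplicity (slotVector f) Y (i, j) := by
      have h3 : 3 ≤ multiplicity (slotVector f) Y (i, j) := by
        have : ({(s₀, false, pairPos k₀ false), (s₀, false, pairPos k₀ true),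
            (s₀, true, pairPos k₀ b)} : Finset (Slot l t)).card = 3 := by
          rw [Finset.card_eq_three]
          exact ⟨_, _, _, by simp [pairPos], by simp, by simp, rfl⟩
        rw [← this]
        apply Finset.card_le_card
        intro a ha
        simp only [Finset.mem_insert, Finset.mem_singleton] at ha
        simp only [Finset.mem_filter, Finset.mem_univ, true_and, Prod.mk.injEq]
        rcases ha with rfl | rfl | rfl
        · simp [slotVector, hk₀, hj]
        · simp [slotVector, hk₀, hY]
        · simp [slotVector, hk₀, hb]
      have := heven (i, j)
      rcases this with ⟨r, hr⟩
      omega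
    have hjI : j ∈ I := by
      simp only [hI, Finset.mem_image, Finset.mem_filter, Finset.mem_univ, true_and]
      exact ⟨(s₀, false, pairPos k₀ false), by simp [slotVector, hk₀], rfl⟩
    rw [← Finset.add_sum_erase _ _ hjI] at hsum
    have h5 := Finset.card_nsmul_le_sum (I.erase j) (fun j => multiplicity (slotVector f) Y (i, j)) 2
      fun x hx => hmult x (Finset.mem_of_mem_erase hx)
    have h6 := Finset.card_erase_add_one hjI
    rw [smul_eq_mul] at h5
    omega
  · left
    have h1 : 1 < (K \ U).card := by
      rw [Finset.one_lt_card]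
      refine ⟨_, hrow false, _, hrow true, fun h => hY ?_⟩
      rw [← (hRa (s₀, false, pairPos k₀ false)).2, h, (hRa _).2]
    omega

end Local

/-! ### Weights of patterns, of vectors and of families of `t`-sets -/

/-- The weighted number of maps to representatives that preserve `F`. -/
lemma sum_prod_rep_le {V β : Type*} [Fintype V] [DecidableEq V] [DecidableEq β] (F : V → β)
    (m : β → ℕ) (hm : ∀ a, 0 < m (F a))
    (hcard : ∀ i, (Finset.univ.filter fun a => F a = i).card = 4 * m i)
    (T : Finset (V → V)) (hT : ∀ R ∈ T, ∀ a, F (R a) = F a) :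
    ∑ R ∈ T, ∏ a, (if R a = a then (1 : ℝ) else (2 * m (F a) : ℝ)⁻¹) ≤ 3 ^ Fintype.card V := by
  have hnn : ∀ a b : V, 0 ≤ (if b = a then (1 : ℝ) else (2 * m (F a) : ℝ)⁻¹) := by
    intro a b; split_ifs <;> positivity
  calc _ ≤ ∑ R ∈ Fintype.piFinset fun a => Finset.univ.filter fun b => F b = F a,
        ∏ a, (if R a = a then (1 : ℝ) else (2 * m (F a) : ℝ)⁻¹) := by
        refine Finset.sum_le_sum_of_subset_of_nonneg (fun R hR => ?_) fun R _ _ =>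
          Finset.prod_nonneg fun a _ => hnn _ _
        simp only [Fintype.mem_piFinset, Finset.mem_filter, Finset.mem_univ, true_and]
        exact hT R hR
    _ = ∏ a, ∑ b ∈ Finset.univ.filter (fun b => F b = F a),
        (if b = a then (1 : ℝ) else (2 * m (F a) : ℝ)⁻¹) := by
        rw [Finset.prod_univ_sum]
    _ ≤ ∏ _a : V, (3 : ℝ) := by
        refine Finset.prod_le_prod (fun a _ => Finset.sum_nonneg fun b _ => hnn _ _) fun a _ => ?_
        have hpos : (0 : ℝ) < m (F a) := by exact_mod_cast hm a
        -- The choice `b = a` adds at most `1`, and the `4 * m` slots of the vector add `4 * m / (2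
        -- * m) = 2`.
        calc _ ≤ ∑ b ∈ Finset.univ.filter (fun b => F b = F a),
              ((if b = a then (1 : ℝ) else 0) + (2 * m (F a) : ℝ)⁻¹) := by
              refine Finset.sum_le_sum fun b _ => ?_
              split_ifs
              · have : 0 ≤ (2 * m (F a) : ℝ)⁻¹ := by positivity
                linarith
              · simp
          _ = 3 := by
              rw [Finset.sum_add_distrib, Finset.sum_const, hcard, Finset.sum_ite_eq']
              simp only [Finset.mem_filter, Finset.mem_univ, true_and, if_true, nsmul_eq_mul]
              push_cast
              field_simp
              norm_num
    _ = _ := by rw [Finset.prod_const, Finset.card_univ]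

/-- The contribution of a vector with `m` occurrences, `k` classes and `u` column-first classes. -/
lemma vector_weight_le {L x y c : ℝ} {m k u : ℕ} (hm : 1 ≤ m) (hmL : (m : ℝ) ≤ L) (hc : 1 ≤ c)
    (hx : 1 ≤ x) (hy : L ^ 3 ≤ y) (hxy : x * L ≤ y)
    (h : u + 2 ≤ k ∧ k ≤ 2 * m ∨ u + 1 ≤ k ∧ k + 1 ≤ 2 * m) :
    (2 * m : ℝ) ^ (4 * m - k) * (c * L) ^ (2 * m - k - 1) * x ^ u * L ^ (m - 1) ≤
      (64 * c ^ 2) ^ m * (m : ℝ) ^ m * y ^ (2 * (m - 1)) := by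
  have hm1 : (1 : ℝ) ≤ m := by exact_mod_cast hm
  have hL : 1 ≤ L := hm1.trans hmL
  have hy0 : 0 ≤ y := le_trans (by positivity) hy
  have hL0 : 0 ≤ L := by linarith
  have hm4 : (m : ℝ) ^ 2 ≤ 4 ^ m := by
    have h1 : (m : ℝ) ≤ 2 ^ m := by exact_mod_cast Nat.lt_two_pow_self.le
    calc (m : ℝ) ^ 2 ≤ (2 ^ m) ^ 2 := by gcongr
      _ = 4 ^ m := by rw [← pow_mul, mul_comm, pow_mul]; norm_num
  -- Of the `2 * (m - 1)` factors `y`, `u` absorb `x * L` each and the others absorb `L ^ 3` each.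
  have hyu : x ^ u * L ^ (u + 3 * (2 * m - 2 - u)) ≤ y ^ (2 * (m - 1)) := by
    calc x ^ u * L ^ (u + 3 * (2 * m - 2 - u)) = (x * L) ^ u * (L ^ 3) ^ (2 * m - 2 - u) := by
          rw [mul_pow, ← pow_mul, pow_add]; ring
      _ ≤ y ^ u * y ^ (2 * m - 2 - u) := by gcongr
      _ = y ^ (2 * (m - 1)) := by rw [← pow_add]; congr 1; omega
  have hmk : (m : ℝ) ^ (3 * m - k) * L ^ (2 * m - k - 1) * L ^ (m - 1) ≤
      4 ^ m * L ^ (u + 3 * (2 * m - 2 - u)) := by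
    -- Here `e` factors `m` go into `4 ^ m` and the remaining ones are replaced by `L`. The two
    -- cases of `h` need `e = 1` and `e = 2`; in the first this is forced by `k = 2 * m`, `u = 2 * m
    -- - 2`, where `2 * m - k - 1` truncates to `0`.
    have hgen : ∀ e, e ≤ 2 → e ≤ 3 * m - k →
        (3 * m - k - e) + (2 * m - k - 1) + (m - 1) ≤ u + 3 * (2 * m - 2 - u) →
        (m : ℝ) ^ (3 * m - k) * L ^ (2 * m - k - 1) * L ^ (m - 1) ≤
          4 ^ m * L ^ (u + 3 * (2 * m - 2 - u)) := by
      intro e he he' hexp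
      calc (m : ℝ) ^ (3 * m - k) * L ^ (2 * m - k - 1) * L ^ (m - 1)
          = (m : ℝ) ^ e * (m : ℝ) ^ (3 * m - k - e) * L ^ (2 * m - k - 1) * L ^ (m - 1) := by
            rw [← pow_add, Nat.add_sub_cancel' he']
        _ ≤ 4 ^ m * L ^ (3 * m - k - e) * L ^ (2 * m - k - 1) * L ^ (m - 1) := by
            gcongr
            exact (pow_le_pow_right₀ hm1 he).trans hm4
        _ = 4 ^ m * L ^ ((3 * m - k - e) + (2 * m - k - 1) + (m - 1)) := by
            rw [pow_add, pow_add]; ring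
        _ ≤ _ := by gcongr
    rcases h with h | h
    · exact hgen 1 (by norm_num) (by omega) (by omega)
    · exact hgen 2 (by norm_num) (by omega) (by omega)
  calc (2 * m : ℝ) ^ (4 * m - k) * (c * L) ^ (2 * m - k - 1) * x ^ u * L ^ (m - 1)
      = (2 : ℝ) ^ (4 * m - k) * c ^ (2 * m - k - 1) * (m : ℝ) ^ m *
        ((m : ℝ) ^ (3 * m - k) * L ^ (2 * m - k - 1) * L ^ (m - 1)) * x ^ u := by
        rw [mul_pow, mul_pow, show 4 * m - k = m + (3 * m - k) by omega, pow_add (m : ℝ)]; ring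
    _ ≤ (2 : ℝ) ^ (4 * m) * c ^ (2 * m) * (m : ℝ) ^ m *
        (4 ^ m * L ^ (u + 3 * (2 * m - 2 - u))) * x ^ u := by
        gcongr
        · norm_num
        · omega
        · omega
    _ = (64 * c ^ 2) ^ m * (m : ℝ) ^ m * (x ^ u * L ^ (u + 3 * (2 * m - 2 - u))) := by
        have h64 : (64 : ℝ) ^ m = 2 ^ (4 * m) * 4 ^ m := by
          rw [pow_mul, ← mul_pow]; norm_num
        rw [mul_pow, ← pow_mul, h64]; ring
    _ ≤ _ := by gcongr

/-- A generating function bound for families of `t`-element sets, weighted by the number of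
occurrences of each element. -/
lemma sum_prod_occurrences_le {n l t : ℕ} (w : ℕ → ℝ) (hw : ∀ m, 0 ≤ w m) {z : ℝ} (hz : 0 ≤ z) :
    (∑ S : Fin l → {S : Finset (Fin n) // S.card = t},
      ∏ i, w (Finset.univ.filter fun s => i ∈ (S s).1).card) * z ^ (t * l) ≤
      (∑ m ∈ Finset.range (l + 1), (l.choose m : ℝ) * (w m * z ^ m)) ^ n := by
  classical
  -- A family is encoded by the incidence set of each element; forgetting that its members have size
  -- `t` makes the sum factor over the `n` elements.
  let Φ : (Fin l → {S : Finset (Fin n) // S.card = t}) → Fin n → Finset (Fin l) :=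
    fun S i => Finset.univ.filter fun s => i ∈ (S s).1
  have hΦ : Function.Injective Φ := by
    intro S S' h
    funext s
    apply Subtype.ext
    ext i
    have := Finset.ext_iff.1 (congrFun h i) s
    simpa [Φ] using this
  have hsum : ∀ S, ∑ i, (Φ S i).card = t * l := by
    intro S
    have : ∑ i, (Φ S i).card = ∑ s, (S s).1.card := by
      simp only [Φ, Finset.card_filter]
      rw [Finset.sum_comm]
      refine Finset.sum_congr rfl fun s _ => ?_
      simp
    rw [this, Finset.sum_congr rfl fun s _ => (S s).2]
    simp [mul_comm]
  have hgen : ∑ m ∈ Finset.range (l + 1), (l.choose m : ℝ) * (w m * z ^ m) =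
      ∑ A : Finset (Fin l), w A.card * z ^ A.card := by
    rw [← Finset.powerset_univ, Finset.sum_powerset_apply_card (fun m => w m * z ^ m)]
    simp
  have hpow : (∑ A : Finset (Fin l), w A.card * z ^ A.card) ^ n =
      ∑ A ∈ Fintype.piFinset fun _ : Fin n => (Finset.univ : Finset (Finset (Fin l))),
        ∏ i, (w (A i).card * z ^ (A i).card) := by
    rw [← Finset.prod_univ_sum (fun _ => Finset.univ)
      (fun (_ : Fin n) (A : Finset (Fin l)) => w A.card * z ^ A.card), Finset.prod_const,
      Finset.card_univ, Fintype.card_fin]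
  rw [hgen, hpow, Finset.sum_mul]
  calc _ = ∑ S : Fin l → {S : Finset (Fin n) // S.card = t},
        ∏ i : Fin n, (w (Φ S i).card * z ^ (Φ S i).card) := by
        refine Finset.sum_congr rfl fun S _ => ?_
        rw [Finset.prod_mul_distrib, Finset.prod_pow_eq_pow_sum, hsum]
    _ = ∑ A ∈ Finset.univ.image Φ, ∏ i : Fin n, (w (A i).card * z ^ (A i).card) := by
        rw [Finset.sum_image hΦ.injOn]
    _ ≤ _ := by
        refine Finset.sum_le_sum_of_subset_of_nonneg (fun A _ => ?_) fun A _ _ =>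
          Finset.prod_nonneg fun i _ => mul_nonneg (hw _) (by positivity)
        simp

/-- The total weight of a vector with `m` occurrences. -/
noncomputable def vectorWeight (μ₄ L q c : ℝ) (m : ℕ) : ℝ :=
  if m = 0 then 1 else μ₄ * (c ^ m * (m : ℝ) ^ m * q ^ (m - 1) / L ^ (m - 1))

/-- From `m ^ m / m! ≤ e ^ m` one gets `l.choose m * m ^ m ≤ (3 * l) ^ m`, and `l ^ m ≤ l * L ^ (m -
1)`. At `(6 * c * q)⁻¹` the terms with `m ≥ 1` are thus at most `(μ₄ * l / q) / 2 ^ m`. -/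
lemma sum_choose_vectorWeight_le {μ₄ L q c : ℝ} {l : ℕ} (hμ : 0 ≤ μ₄) (hL : 0 < L)
    (hlL : (l : ℝ) ≤ L) (hq : 0 < q) (hc : 0 < c) :
    ∑ m ∈ Finset.range (l + 1), (l.choose m : ℝ) * (vectorWeight μ₄ L q c m * (6 * c * q)⁻¹ ^ m) ≤
      1 + μ₄ * l / q := by
  rw [Finset.sum_range_succ']
  simp only [vectorWeight, Nat.succ_ne_zero, if_false, if_true, Nat.choose_zero_right, pow_zero,
    Nat.cast_one, mul_one, Nat.add_sub_cancel]
  rw [add_comm]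
  gcongr
  have hterm : ∀ m ∈ Finset.range l, (l.choose (m + 1) : ℝ) *
      (μ₄ * (c ^ (m + 1) * ((m + 1 : ℕ) : ℝ) ^ (m + 1) * q ^ m / L ^ m) * (6 * c * q)⁻¹ ^ (m + 1)) ≤
      μ₄ * l / q * (1 / 2) * (1 / 2) ^ m := by
    intro m _
    have h1 : (l.choose (m + 1) : ℝ) * ((m + 1 : ℕ) : ℝ) ^ (m + 1) ≤ (l : ℝ) ^ (m + 1) * 3 ^ (m + 1) := by
      have h2 : (l.choose (m + 1) : ℝ) ≤ (l : ℝ) ^ (m + 1) / (m + 1).factorial :=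
        Nat.choose_le_pow_div _ _
      have h3 : ((m + 1 : ℕ) : ℝ) ^ (m + 1) / (m + 1).factorial ≤ 3 ^ (m + 1) := by
        refine (Real.pow_div_factorial_le_exp _ (Nat.cast_nonneg _) _).trans ?_
        rw [← Real.exp_one_pow]
        exact pow_le_pow_left₀ (Real.exp_pos _).le Real.exp_one_lt_three.le _
      calc _ ≤ (l : ℝ) ^ (m + 1) / (m + 1).factorial * ((m + 1 : ℕ) : ℝ) ^ (m + 1) := by gcongr
        _ = (l : ℝ) ^ (m + 1) * (((m + 1 : ℕ) : ℝ) ^ (m + 1) / (m + 1).factorial) := by ring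
        _ ≤ _ := by gcongr
    calc _ = ((l.choose (m + 1) : ℝ) * ((m + 1 : ℕ) : ℝ) ^ (m + 1)) *
          (μ₄ * (c ^ (m + 1) * q ^ m / L ^ m) * (6 * c * q)⁻¹ ^ (m + 1)) := by ring
      _ ≤ ((l : ℝ) * L ^ m * 3 ^ (m + 1)) *
          (μ₄ * (c ^ (m + 1) * q ^ m / L ^ m) * (6 * c * q)⁻¹ ^ (m + 1)) := by
          refine mul_le_mul_of_nonneg_right (h1.trans ?_) (by positivity)
          rw [pow_succ' (l : ℝ)]
          gcongr
      _ = _ := by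
          rw [inv_pow, mul_pow, mul_pow, show (6 : ℝ) = 3 * 2 by norm_num, mul_pow, div_pow]
          field_simp
          ring
  refine (Finset.sum_le_sum hterm).trans ?_
  rw [← Finset.mul_sum]
  have hgeo : ∑ m ∈ Finset.range l, (1 / 2 : ℝ) ^ m ≤ 2 := sum_geometric_two_le l
  have : 0 ≤ μ₄ * l / q := by positivity
  nlinarith

/-- The generating function is at most `(1 + μ₄ * l / q) ^ n ≤ exp (t * l) ≤ 3 ^ (t * l)`; dividing
by `(6 * c * q)⁻¹ ^ (t * l)` gives the constant `18`. -/
lemma sum_prod_vectorWeight_le {μ₄ L q c : ℝ} {n l t : ℕ} (hμ : 0 ≤ μ₄) (hL : 0 < L)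
    (hlL : (l : ℝ) ≤ L) (hq : 0 < q) (hc : 0 < c) (hnq : μ₄ * n ≤ t * q) :
    ∑ S : Fin l → {S : Finset (Fin n) // S.card = t},
      ∏ i, vectorWeight μ₄ L q c (Finset.univ.filter fun s => i ∈ (S s).1).card ≤
      (18 * c * q) ^ (t * l) := by
  have hw : ∀ m, 0 ≤ vectorWeight μ₄ L q c m := by
    intro m
    unfold vectorWeight
    split_ifs <;> positivity
  have h1 := sum_prod_occurrences_le (n := n) (l := l) (t := t) (vectorWeight μ₄ L q c) hw
    (z := (6 * c * q)⁻¹) (by positivity)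
  have h2 : (∑ m ∈ Finset.range (l + 1),
      (l.choose m : ℝ) * (vectorWeight μ₄ L q c m * (6 * c * q)⁻¹ ^ m)) ^ n ≤ 3 ^ (t * l) := by
    have h4 : (1 + μ₄ * l / q) ^ n ≤ Real.exp (t * l) := by
      calc (1 + μ₄ * l / q) ^ n ≤ Real.exp (μ₄ * l / q) ^ n := by
            gcongr
            rw [add_comm]
            exact Real.add_one_le_exp _
        _ = Real.exp (n * (μ₄ * l / q)) := (Real.exp_nat_mul _ _).symm
        _ ≤ _ := by
            apply Real.exp_le_exp.2
            calc n * (μ₄ * l / q) = (μ₄ * n) * l / q := by ring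
              _ ≤ (t * q) * l / q := by gcongr
              _ = t * l := by field_simp
    calc _ ≤ (1 + μ₄ * l / q) ^ n :=
          pow_le_pow_left₀ (Finset.sum_nonneg fun m _ => mul_nonneg (Nat.cast_nonneg _)
            (mul_nonneg (hw m) (by positivity))) (sum_choose_vectorWeight_le hμ hL hlL hq hc) n
      _ ≤ _ := h4
      _ = Real.exp 1 ^ (t * l) := by rw [Real.exp_one_pow]; push_cast; rfl
      _ ≤ _ := pow_le_pow_left₀ (Real.exp_pos _).le Real.exp_one_lt_three.le _
  have h3 := h1.trans h2
  rw [inv_pow, ← div_eq_mul_inv, div_le_iff₀ (by positivity)] at h3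
  refine h3.trans (le_of_eq ?_)
  rw [← mul_pow]
  ring

/-! ### Summing over walks and row permutations for fixed `t`-sets -/

section Walks

variable {l t n d : ℕ}

/-- The labellings of the slots that can have a nonzero expected value: every entry occurs an even
number of times, and no row index of a factor is a pair `(j, j)` that does not meet the column. -/
def IsGood (f : Fin l → Fin t → Fin n) (Y : Slot l t → Fin d) : Prop :=
  (∀ p, Even (multiplicity (slotVector f) Y p)) ∧
    ∀ s k, Y (s, false, pairPos k false) = Y (s, false, pairPos k true) →
      ∃ b, Y (s, true, pairPos k b) = Y (s, false, pairPos k false)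

/-- The number of classes of the vector `i`. -/
def classCount (f : Fin l → Fin t → Fin n) (R : Slot l t → Slot l t) (i : Fin n) : ℕ :=
  (Finset.univ.filter fun a => slotVector f a = i ∧ R a = a).card

lemma occurrences_pos {f : Fin l → Fin t → Fin n} {i : Fin n}
    (hi : i ∈ Finset.univ.image (slotVector f)) : 0 < occurrences f i := by
  obtain ⟨a, -, ha⟩ := Finset.mem_image.1 hi
  exact Finset.card_pos.2 ⟨a.1, by simp only [Finset.mem_filter, Finset.mem_univ, true_and]; exact ⟨_, ha⟩⟩

lemma occurrences_le (f : Fin l → Fin t → Fin n) (i : Fin n) : occurrences f i ≤ l :=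
  (Finset.card_le_univ _).trans (by simp)

lemma occurrences_eq_zero {f : Fin l → Fin t → Fin n} {i : Fin n}
    (hf : ∀ s, Function.Injective (f s))
    (hi : i ∉ Finset.univ.image (slotVector f)) : occurrences f i = 0 := by
  have h := card_slotVector f hf i
  have : (Finset.univ.filter fun a => slotVector f a = i).card = 0 := by
    rw [Finset.card_eq_zero, Finset.filter_eq_empty_iff]
    intro a _ ha
    exact hi (Finset.mem_image.2 ⟨a, Finset.mem_univ _, ha⟩)
  omega

lemma classCount_add_card (f : Fin l → Fin t → Fin n) (hf : ∀ s, Function.Injective (f s))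
    (R : Slot l t → Slot l t) (i : Fin n) :
    classCount f R i + ((Finset.univ.filter fun a => slotVector f a = i).filter
      fun a => ¬ R a = a).card = 4 * occurrences f i := by
  rw [← card_slotVector f hf, classCount, ← Finset.filter_filter,
    Finset.card_filter_add_card_filter_not]

lemma prod_rep_weight (f : Fin l → Fin t → Fin n) (hf : ∀ s, Function.Injective (f s))
    (R : Slot l t → Slot l t) :
    ∏ a, (if R a = a then (1 : ℝ) else (2 * occurrences f (slotVector f a) : ℝ)⁻¹) =
      ∏ i ∈ Finset.univ.image (slotVector f),
        ((2 * occurrences f i : ℝ) ^ (4 * occurrences f i - classCount f R i))⁻¹ := by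
  rw [← Finset.prod_fiberwise_of_maps_to (g := slotVector f)
    (t := Finset.univ.image (slotVector f)) (fun a _ => Finset.mem_image_of_mem _ (Finset.mem_univ a))]
  refine Finset.prod_congr rfl fun i _ => ?_
  have h1 : ∀ a ∈ Finset.univ.filter fun a => slotVector f a = i,
      (if R a = a then (1 : ℝ) else (2 * occurrences f (slotVector f a) : ℝ)⁻¹) =
        if ¬ R a = a then (2 * occurrences f i : ℝ)⁻¹ else 1 := by
    intro a ha
    rw [(Finset.mem_filter.1 ha).2]
    split_ifs <;> rfl
  rw [Finset.prod_congr rfl h1, ← Finset.prod_filter, Finset.prod_const, inv_pow]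
  have := classCount_add_card f hf R i
  congr 2
  omega

variable {μ₄ L c y : ℝ}

/-- The expected value of a labelling together with the count of its free labels, vector by
vector. -/
lemma prod_weight_le (ht : 1 ≤ t) (htd : t ≤ d) (hμ : 1 ≤ μ₄) (hlL : (l : ℝ) ≤ L) (hc : 1 ≤ c)
    (hy : L ^ 3 ≤ y) (hxy : (d : ℝ) / t * L ≤ y) (f : Fin l → Fin t → Fin n)
    (hf : ∀ s, Function.Injective (f s)) (Y : Slot l t → Fin d) (hY : IsGood f Y)
    (R : Slot l t → Slot l t) (hR : R = rep fun a => (slotVector f a, Y a)) :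
    (∏ i ∈ Finset.univ.image (slotVector f),
        μ₄ * (c * L) ^ (2 * occurrences f i - classCount f R i - 1)) *
        ((d : ℝ) / t) ^ (colFirst R).card ≤
      (∏ i, vectorWeight μ₄ L (y ^ 2) (64 * c ^ 2) (occurrences f i)) *
        ∏ a, (if R a = a then (1 : ℝ) else (2 * occurrences f (slotVector f a) : ℝ)⁻¹) := by
  have hu : (colFirst R).card = ∑ i ∈ Finset.univ.image (slotVector f),
      ((colFirst R).filter fun r => slotVector f r = i).card :=
    Finset.card_eq_sum_card_fiberwise
      (by intro a _; exact Finset.mem_coe.2 (Finset.mem_image_of_mem _ (Finset.mem_univ a)))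
  rw [prod_rep_weight f hf, hu, ← Finset.prod_pow_eq_pow_sum, ← Finset.prod_mul_distrib,
    ← Finset.prod_subset (Finset.subset_univ (Finset.univ.image (slotVector f)))
      (f := fun i => vectorWeight μ₄ L (y ^ 2) (64 * c ^ 2) (occurrences f i)),
    ← Finset.prod_mul_distrib]
  · have hx : 1 ≤ (d : ℝ) / t := by
      rw [le_div_iff₀ (by exact_mod_cast ht), one_mul]
      exact_mod_cast htd
    have hL0 : 0 ≤ L := le_trans (Nat.cast_nonneg l) hlL
    refine Finset.prod_le_prod (fun i _ => by positivity) fun i hi => ?_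
    have hm := occurrences_pos hi
    have hmL : (occurrences f i : ℝ) ≤ L :=
      le_trans (by exact_mod_cast occurrences_le f i) hlL
    have hcol := colFirst_add_le f Y hf hY.1 hY.2 i hi
    rw [← hR] at hcol
    have := vector_weight_le hm hmL hc hx hy hxy hcol
    rw [vectorWeight, if_neg hm.ne']
    have hL : 0 < L := lt_of_lt_of_le (by exact_mod_cast hm) hmL
    change _ * _ ^ (_ - classCount f R i - 1) * _ ≤ _
    change _ ^ (_ - classCount f R i) * _ ^ (_ - classCount f R i - 1) * _ * _ ≤ _ at this
    rw [← div_eq_mul_inv, le_div_iff₀ (by positivity)]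
    rw [← le_div_iff₀ (by positivity)] at this
    rw [← pow_mul]
    calc _ = μ₄ * ((2 * occurrences f i : ℝ) ^ (4 * occurrences f i - classCount f R i) *
          (c * L) ^ (2 * occurrences f i - classCount f R i - 1) *
          ((d : ℝ) / t) ^ ((colFirst R).filter fun r => slotVector f r = i).card) := by ring
      _ ≤ _ := by gcongr
  · intro i _ hi
    rw [occurrences_eq_zero hf hi, vectorWeight, if_pos rfl]

/-- The sum of the expected values over all closed walks and all permutations of the rows. -/
lemma sum_walks_le {f : Fin (l + 1) → Fin t → Fin n} (ht : 1 ≤ t) (htd : t ≤ d) (hμ : 1 ≤ μ₄)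
    (hlL : ((l + 1 : ℕ) : ℝ) ≤ L) (hc : 1 ≤ c)
    (hy : L ^ 3 ≤ y) (hxy : (d : ℝ) / t * L ≤ y)
    (hf : ∀ s, Function.Injective (f s)) (E : (Slot (l + 1) t → Fin d) → ℝ) {G : ℝ} (hG : 0 ≤ G)
    (hbad : ∀ Y, ¬ IsGood f Y → E Y = 0)
    (hgood : ∀ Y, IsGood f Y → E Y ≤ G * ∏ i ∈ Finset.univ.image (slotVector f),
      μ₄ * (c * L) ^ ((Finset.univ.filter fun a => slotVector f a = i).card / 2 -
        ((Finset.univ.filter fun a => slotVector f a = i).image Y).card - 1))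
    (π' : Fin (l + 1) → Equiv.Perm (Fin (2 * t))) :
    ∑ π : Fin (l + 1) → Equiv.Perm (Fin (2 * t)), ∑ x : Fin (l + 1) → Fin (2 * t) → Fin d,
      E (slotLabel x π π') ≤
      G * ((d : ℝ) / t) ^ (2 * t) * (8 ^ t * (2 * t).factorial) ^ (l + 1) *
        3 ^ (4 * t * (l + 1)) *
        ∏ i, vectorWeight μ₄ L (y ^ 2) (64 * c ^ 2) (occurrences f i) := by
  classical
  have hL0 : 0 ≤ L := le_trans (Nat.cast_nonneg _) hlL
  let T : Finset (Slot (l + 1) t → Slot (l + 1) t) := Finset.univ.filter fun R =>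
    ∃ Y : Slot (l + 1) t → Fin d, IsGood f Y ∧ R = rep fun a => (slotVector f a, Y a)
  let W : (Slot (l + 1) t → Slot (l + 1) t) → ℝ := fun R =>
    G * ∏ i ∈ Finset.univ.image (slotVector f),
      μ₄ * (c * L) ^ (2 * occurrences f i - classCount f R i - 1)
  have hW : ∀ R, 0 ≤ W R := fun R =>
    mul_nonneg hG (Finset.prod_nonneg fun i _ => by positivity)
  -- Admitting every pattern compatible with `Y`, not only its own, overcounts but decouples `R`
  -- from the walk, so that walks can be counted for each `R` separately.
  have hE : ∀ Y : Slot (l + 1) t → Fin d,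
      E Y ≤ ∑ R ∈ T, if ∀ a b, R a = R b → Y a = Y b then W R else 0 := by
    intro Y
    by_cases hY : IsGood f Y
    · refine le_trans ?_ (Finset.single_le_sum (f := fun R : Slot (l + 1) t → Slot (l + 1) t =>
        if ∀ a b, R a = R b → Y a = Y b then W R else 0)
        (fun R _ => by split_ifs; exacts [hW R, le_rfl])
        (a := rep fun a => (slotVector f a, Y a))
        (by simp only [T, Finset.mem_filter, Finset.mem_univ, true_and]; exact ⟨Y, hY, rfl⟩))
      rw [if_pos fun a b h => congrArg Prod.snd ((rep_eq_rep_iff _ _ _).1 h)]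
      refine (hgood Y hY).trans (le_of_eq ?_)
      simp only [W]
      congr 1
      refine Finset.prod_congr rfl fun i _ => ?_
      rw [card_image_label, card_slotVector f hf]
      congr 2
      rw [classCount]
      omega
    · rw [hbad Y hY]
      exact Finset.sum_nonneg fun R _ => by split_ifs; exacts [hW R, le_rfl]
  have hTR : ∀ R ∈ T, (∀ a, R (R a) = R a) ∧
      (∀ r, Even (Finset.univ.filter fun a => R a = r).card) ∧
      ∀ a, slotVector f (R a) = slotVector f a := by
    intro R hR
    simp only [T, Finset.mem_filter, Finset.mem_univ, true_and] at hR
    obtain ⟨Y, hY, rfl⟩ := hR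
    refine ⟨rep_rep _, fun r => ?_, fun a =>
      congrArg Prod.fst (apply_rep (fun a => (slotVector f a, Y a)) a)⟩
    by_cases hr : rep (fun a => (slotVector f a, Y a)) r = r
    · have h1 := hY.1 (slotVector f r, Y r)
      rw [multiplicity] at h1
      convert h1 using 4 with a
      rw [← rep_eq_rep_iff (fun a => (slotVector f a, Y a)) a r, hr]
    · rw [Finset.filter_eq_empty_iff.2]
      · simp
      · rintro a - rfl
        exact hr (rep_rep _ _)
  calc _ ≤ ∑ π : Fin (l + 1) → Equiv.Perm (Fin (2 * t)),
        ∑ x : Fin (l + 1) → Fin (2 * t) → Fin d, ∑ R ∈ T,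
          if ∀ a b, R a = R b → slotLabel x π π' a = slotLabel x π π' b then W R else 0 :=
        Finset.sum_le_sum fun π _ => Finset.sum_le_sum fun x _ => hE _
    _ = ∑ R ∈ T, W R * ∑ π : Fin (l + 1) → Equiv.Perm (Fin (2 * t)),
        ((Finset.univ.filter fun x : Fin (l + 1) → Fin (2 * t) → Fin d =>
          ∀ a b, R a = R b → slotLabel x π π' a = slotLabel x π π' b).card : ℝ) := by
        have h1 : ∀ π : Fin (l + 1) → Equiv.Perm (Fin (2 * t)),
            ∑ x : Fin (l + 1) → Fin (2 * t) → Fin d, ∑ R ∈ T,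
              (if ∀ a b, R a = R b → slotLabel x π π' a = slotLabel x π π' b then W R else 0) =
            ∑ R ∈ T, W R * ((Finset.univ.filter fun x : Fin (l + 1) → Fin (2 * t) → Fin d =>
              ∀ a b, R a = R b → slotLabel x π π' a = slotLabel x π π' b).card : ℝ) := by
          intro π
          rw [Finset.sum_comm]
          refine Finset.sum_congr rfl fun R _ => ?_
          rw [← Finset.sum_filter, Finset.sum_const, nsmul_eq_mul, mul_comm]
        simp_rw [h1, Finset.mul_sum]
        rw [Finset.sum_comm]
    _ ≤ ∑ R ∈ T, W R * (((d : ℝ) / t) ^ (2 * t + (colFirst R).card) *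
        (8 ^ t * (2 * t).factorial) ^ (l + 1)) := by
        refine Finset.sum_le_sum fun R hR => mul_le_mul_of_nonneg_left ?_ (hW R)
        exact sum_card_labels_le R π' ht htd (hTR R hR).1 (hTR R hR).2.1
    _ ≤ ∑ R ∈ T, G * ((d : ℝ) / t) ^ (2 * t) * (8 ^ t * (2 * t).factorial) ^ (l + 1) *
        ((∏ i, vectorWeight μ₄ L (y ^ 2) (64 * c ^ 2) (occurrences f i)) *
        ∏ a, (if R a = a then (1 : ℝ) else (2 * occurrences f (slotVector f a) : ℝ)⁻¹)) := by
        refine Finset.sum_le_sum fun R hR => ?_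
        simp only [T, Finset.mem_filter, Finset.mem_univ, true_and] at hR
        obtain ⟨Y, hY, hRY⟩ := hR
        have := prod_weight_le ht htd hμ hlL hc hy hxy f hf Y hY R hRY
        calc _ = G * ((d : ℝ) / t) ^ (2 * t) * (8 ^ t * (2 * t).factorial) ^ (l + 1) *
            ((∏ i ∈ Finset.univ.image (slotVector f),
              μ₄ * (c * L) ^ (2 * occurrences f i - classCount f R i - 1)) *
              ((d : ℝ) / t) ^ (colFirst R).card) := by
              simp only [W]
              rw [pow_add]
              ring
          _ ≤ _ := by gcongr
    _ = G * ((d : ℝ) / t) ^ (2 * t) * (8 ^ t * (2 * t).factorial) ^ (l + 1) *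
        (∏ i, vectorWeight μ₄ L (y ^ 2) (64 * c ^ 2) (occurrences f i)) *
        ∑ R ∈ T, ∏ a, (if R a = a then (1 : ℝ) else (2 * occurrences f (slotVector f a) : ℝ)⁻¹) := by
        rw [Finset.mul_sum]
        exact Finset.sum_congr rfl fun R _ => by ring
    _ ≤ G * ((d : ℝ) / t) ^ (2 * t) * (8 ^ t * (2 * t).factorial) ^ (l + 1) *
        (∏ i, vectorWeight μ₄ L (y ^ 2) (64 * c ^ 2) (occurrences f i)) *
        3 ^ (4 * t * (l + 1)) := by
        have hcardV : Fintype.card (Slot (l + 1) t) = 4 * t * (l + 1) := by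
          simp; ring
        rw [← hcardV]
        refine mul_le_mul_of_nonneg_left ?_ ?_
        · exact sum_prod_rep_le (slotVector f) (occurrences f)
            (fun a => occurrences_pos (Finset.mem_image_of_mem _ (Finset.mem_univ a)))
            (card_slotVector f hf) T fun R hR => (hTR R hR).2.2
        · refine mul_nonneg (by positivity) (Finset.prod_nonneg fun i _ => ?_)
          unfold vectorWeight
          split_ifs <;> positivity
    _ = _ := by ring

end Walks

/-! ### Expansion of the trace over closed walks -/

section Trace

lemma pow_succ_apply {ι : Type*} [Fintype ι] [DecidableEq ι] (A : Matrix ι ι ℝ) (l : ℕ) :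
    ∀ i j, (A ^ (l + 1)) i j = ∑ x : Fin (l + 1) → ι, if x 0 = i then
      (∏ s : Fin l, A (x s.castSucc) (x s.succ)) * A (x (Fin.last l)) j else 0 := by
  induction l with
  | zero =>
    intro i j
    refine Eq.trans ?_ ((Equiv.funUnique (Fin 1) ι).symm.sum_comp _)
    simp
  | succ l ih =>
    intro i j
    rw [pow_succ', Matrix.mul_apply]
    simp_rw [ih, Finset.mul_sum]
    refine Eq.trans ?_ ((Fin.consEquiv fun _ => ι).sum_comp _)
    rw [Fintype.sum_prod_type, Finset.sum_comm, Finset.sum_comm (s := Finset.univ (α := ι))]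
    refine Finset.sum_congr rfl fun x _ => ?_
    simp only [Fin.consEquiv_apply, Fin.cons_zero, Fin.prod_univ_succ, Fin.castSucc_zero,
      Fin.cons_succ, ← Fin.succ_last, ← Fin.succ_castSucc]
    simp [mul_assoc]

lemma trace_pow_succ {ι : Type*} [Fintype ι] [DecidableEq ι] (A : Matrix ι ι ℝ) (l : ℕ) :
    Matrix.trace (A ^ (l + 1)) = ∑ x : Fin (l + 1) → ι, ∏ s, A (x s) (x (s + 1)) := by
  rw [Matrix.trace]
  simp only [Matrix.diag_apply, pow_succ_apply]
  rw [Finset.sum_comm]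
  refine Finset.sum_congr rfl fun x _ => ?_
  rw [Finset.sum_ite_eq, if_pos (Finset.mem_univ _), Fin.prod_univ_castSucc]
  simp

lemma prod_sum_fun {ι κ : Type*} [Fintype ι] [DecidableEq ι] [Fintype κ] (g : ι → κ → ℝ) :
    ∏ s, ∑ i, g s i = ∑ x : ι → κ, ∏ s, g s (x s) := by
  rw [Finset.prod_univ_sum, Fintype.piFinset_univ]

variable {d t : ℕ}

lemma permMat_mul_mul_apply (π π' : Equiv.Perm (Fin (2 * t)))
    (B : Matrix (Fin (2 * t) → Fin d) (Fin (2 * t) → Fin d) ℝ) (I J : Fin (2 * t) → Fin d) :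
    (permMat (d := d) π * B * permMat (d := d) π' : Matrix _ _ ℝ) I J = B (I ∘ π.symm) (J ∘ π') := by
  have h1 : ∀ K : Fin (2 * t) → Fin d, I = K ∘ π ↔ K = I ∘ π.symm := by
    intro K
    constructor
    · rintro rfl
      funext p
      simp
    · rintro rfl
      funext p
      simp
  rw [Matrix.mul_apply]
  simp only [permMat, Matrix.of_apply, mul_ite, mul_one, mul_zero, Finset.sum_ite_eq',
    Finset.mem_univ, if_true]
  rw [Matrix.mul_apply]
  simp only [Matrix.of_apply, h1, ite_mul, one_mul, zero_mul, Finset.sum_ite_eq', Finset.mem_univ,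
    if_true]

lemma symM_apply {n : ℕ} (a : Fin n → Fin d → ℝ) (I J : Fin (2 * t) → Fin d) :
    symM t a I J = (((2 * t).factorial : ℝ) ^ 2)⁻¹ * t.factorial *
      ∑ π : Equiv.Perm (Fin (2 * t)), ∑ π' : Equiv.Perm (Fin (2 * t)),
        ∑ S : {S : Finset (Fin n) // S.card = t}, ∏ k : Fin t,
          Shift (tensorFour (a (S.1.orderEmbOfFin S.2 k))) (pairAt (I ∘ π) k)
            (pairAt (J ∘ π') k) := by
  rw [symM, Matrix.smul_apply, Matrix.sum_apply,
    ← Equiv.sum_comp (Equiv.inv (Equiv.Perm (Fin (2 * t)))),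
    smul_eq_mul, mul_assoc]
  congr 1
  rw [Finset.mul_sum]
  refine Finset.sum_congr rfl fun π _ => ?_
  rw [Matrix.sum_apply, Finset.mul_sum]
  refine Finset.sum_congr rfl fun π' _ => ?_
  rw [permMat_mul_mul_apply, bigM, Matrix.smul_apply, Matrix.sum_apply, smul_eq_mul]
  rfl

/-- The factor by which `Shift` multiplies an entry. -/
noncomputable def shiftCoef (p q : Fin d × Fin d) : ℝ :=
  if (p.1 = p.2 ∧ p.1 ∉ ({q.1, q.2} : Finset (Fin d))) ∨
      (q.1 = q.2 ∧ q.1 ∉ ({p.1, p.2} : Finset (Fin d))) then 0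
  else if p.1 ≠ p.2 ∧ q.1 ≠ q.2 ∧ ({p.1, p.2, q.1, q.2} : Finset (Fin d)).card ≤ 3 then 3 / 2
  else 1

lemma Shift_apply (A : Matrix (Fin d × Fin d) (Fin d × Fin d) ℝ) (p q : Fin d × Fin d) :
    Shift A p q = shiftCoef p q * A p q := by
  rw [Shift, Matrix.of_apply, shiftCoef]
  split_ifs <;> simp

lemma shiftCoef_nonneg (p q : Fin d × Fin d) : 0 ≤ shiftCoef p q := by
  rw [shiftCoef]; split_ifs <;> norm_num

lemma shiftCoef_le (p q : Fin d × Fin d) : shiftCoef p q ≤ 3 / 2 := by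
  rw [shiftCoef]; split_ifs <;> norm_num

/-- The labels of the row (`b = false`) or column (`b = true`) pair of the `k`-th block of the
`s`-th factor. -/
def slotPair {l : ℕ} (Y : Slot l t → Fin d) (s : Fin l) (b : Bool) (k : Fin t) : Fin d × Fin d :=
  (Y (s, b, pairPos k false), Y (s, b, pairPos k true))

/-- The product of the factors of `Shift` over all blocks. -/
noncomputable def walkCoef {l : ℕ} (Y : Slot l t → Fin d) : ℝ :=
  ∏ s, ∏ k, shiftCoef (slotPair Y s false k) (slotPair Y s true k)

lemma walkCoef_le {l : ℕ} (Y : Slot l t → Fin d) : walkCoef Y ≤ (3 / 2) ^ (t * l) := by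
  calc walkCoef Y ≤ ∏ _s : Fin l, ∏ _k : Fin t, (3 / 2 : ℝ) :=
        Finset.prod_le_prod (fun _ _ => Finset.prod_nonneg fun _ _ => shiftCoef_nonneg _ _)
          fun _ _ => Finset.prod_le_prod (fun _ _ => shiftCoef_nonneg _ _)
            fun _ _ => shiftCoef_le _ _
    _ = _ := by simp only [Finset.prod_const, Finset.card_univ, Fintype.card_fin, pow_mul]

lemma exists_of_walkCoef_ne_zero {l : ℕ} {Y : Slot l t → Fin d} (h : walkCoef Y ≠ 0) (s : Fin l)
    (k : Fin t) (hY : Y (s, false, pairPos k false) = Y (s, false, pairPos k true)) :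
    ∃ b, Y (s, true, pairPos k b) = Y (s, false, pairPos k false) := by
  by_contra hb
  push Not at hb
  apply h
  refine Finset.prod_eq_zero (Finset.mem_univ s) (Finset.prod_eq_zero (Finset.mem_univ k) ?_)
  rw [shiftCoef, if_pos]
  left
  refine ⟨hY, ?_⟩
  simp only [slotPair, Finset.mem_insert, Finset.mem_singleton, not_or]
  exact ⟨fun h => hb false h.symm, fun h => hb true h.symm⟩

lemma prod_Shift_eq {n l : ℕ} (a : Fin n → Fin d → ℝ) (f : Fin (l + 1) → Fin t → Fin n)
    (x : Fin (l + 1) → Fin (2 * t) → Fin d) (π π' : Fin (l + 1) → Equiv.Perm (Fin (2 * t))) :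
    ∏ s, ∏ k, Shift (tensorFour (a (f s k))) (pairAt (x s ∘ π s) k) (pairAt (x (s + 1) ∘ π' s) k) =
      walkCoef (slotLabel x π π') * ∏ v, a (slotVector f v) (slotLabel x π π' v) := by
  rw [Fintype.prod_prod_type, walkCoef, ← Finset.prod_mul_distrib]
  refine Finset.prod_congr rfl fun s _ => ?_
  rw [Fintype.prod_prod_type, Fintype.prod_bool, prod_eq_prod_pairPos, prod_eq_prod_pairPos,
    ← Finset.prod_mul_distrib, ← Finset.prod_mul_distrib]
  refine Finset.prod_congr rfl fun k _ => ?_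
  simp only [slotVector, half_pairPos]
  rw [Shift_apply]
  simp only [tensorFour, Matrix.of_apply, slotPair, slotLabel, pairAt, pairPos, Function.comp_apply,
    if_true, Bool.false_eq_true, if_false]
  ring

/-- The trace of a power of the symmetrized matrix as a sum over closed walks. -/
lemma trace_symM_pow {n l : ℕ} (a : Fin n → Fin d → ℝ) :
    Matrix.trace (symM t a ^ (l + 1)) =
      ((((2 * t).factorial : ℝ) ^ 2)⁻¹ * t.factorial) ^ (l + 1) *
      ∑ π' : Fin (l + 1) → Equiv.Perm (Fin (2 * t)),
      ∑ S : Fin (l + 1) → {S : Finset (Fin n) // S.card = t},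
      ∑ π : Fin (l + 1) → Equiv.Perm (Fin (2 * t)),
      ∑ x : Fin (l + 1) → Fin (2 * t) → Fin d,
        walkCoef (slotLabel x π π') *
          ∏ v, a (slotVector (fun s k => (S s).1.orderEmbOfFin (S s).2 k) v)
            (slotLabel x π π' v) := by
  rw [trace_pow_succ]
  simp_rw [symM_apply, Finset.prod_mul_distrib, prod_sum_fun]
  rw [← Finset.mul_sum]
  congr 1
  · simp [mul_pow]
  rw [Finset.sum_comm]
  rw [show (∑ π : Fin (l + 1) → Equiv.Perm (Fin (2 * t)),
      ∑ x : Fin (l + 1) → Fin (2 * t) → Fin d, ∑ π' : Fin (l + 1) → Equiv.Perm (Fin (2 * t)),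
      ∑ S : Fin (l + 1) → {S : Finset (Fin n) // S.card = t}, ∏ s, ∏ k : Fin t,
          Shift (tensorFour (a ((S s).1.orderEmbOfFin (S s).2 k))) (pairAt (x s ∘ π s) k)
            (pairAt (x (s + 1) ∘ π' s) k)) =
      ∑ π : Fin (l + 1) → Equiv.Perm (Fin (2 * t)), ∑ π' : Fin (l + 1) → Equiv.Perm (Fin (2 * t)),
      ∑ S : Fin (l + 1) → {S : Finset (Fin n) // S.card = t},
      ∑ x : Fin (l + 1) → Fin (2 * t) → Fin d, ∏ s, ∏ k : Fin t,
          Shift (tensorFour (a ((S s).1.orderEmbOfFin (S s).2 k))) (pairAt (x s ∘ π s) k)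
            (pairAt (x (s + 1) ∘ π' s) k) from ?_]
  · rw [Finset.sum_comm]
    refine Finset.sum_congr rfl fun π' _ => ?_
    rw [Finset.sum_comm]
    refine Finset.sum_congr rfl fun S _ => Finset.sum_congr rfl fun π _ =>
      Finset.sum_congr rfl fun x _ => ?_
    exact prod_Shift_eq a (fun s k => (S s).1.orderEmbOfFin (S s).2 k) x π π'
  · refine Finset.sum_congr rfl fun π _ => ?_
    rw [Finset.sum_comm]
    refine Finset.sum_congr rfl fun π' _ => Finset.sum_comm

lemma occurrences_orderEmbOfFin {n l : ℕ} (S : Fin l → {S : Finset (Fin n) // S.card = t})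
    (i : Fin n) : occurrences (fun s k => (S s).1.orderEmbOfFin (S s).2 k) i =
      (Finset.univ.filter fun s => i ∈ (S s).1).card := by
  rw [occurrences]
  congr 1
  ext s
  have := Finset.range_orderEmbOfFin (S s).1 (S s).2
  simp only [Finset.mem_filter, Finset.mem_univ, true_and]
  rw [← Finset.mem_coe, ← this, Set.mem_range]

end Trace

/-! ### The expected trace -/

section Main

variable {Ω : Type*} [MeasurableSpace Ω] {P : Measure Ω} [IsProbabilityMeasure P] {n d t : ℕ}
  {a : Fin n → Fin d → Ω → ℝ}

lemma integrable_trace_symM_pow (ha : ∀ i j, Measurable (a i j)) {B : ℝ}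
    (hb : ∀ i j, ∀ᵐ ω ∂P, a i j ω ^ 2 ≤ B) (l : ℕ) :
    Integrable (fun ω => Matrix.trace (symM t (fun i j => a i j ω) ^ (l + 1))) P := by
  simp_rw [trace_symM_pow]
  refine Integrable.const_mul ?_ _
  refine integrable_finsetSum _ fun π' _ => integrable_finsetSum _ fun S _ =>
    integrable_finsetSum _ fun π _ => integrable_finsetSum _ fun x _ => ?_
  exact (integrable_prod ha hb _ _).const_mul _

lemma integral_trace_symM_pow (ha : ∀ i j, Measurable (a i j)) {B : ℝ}
    (hb : ∀ i j, ∀ᵐ ω ∂P, a i j ω ^ 2 ≤ B) (l : ℕ) :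
    ∫ ω, Matrix.trace (symM t (fun i j => a i j ω) ^ (l + 1)) ∂P =
      ((((2 * t).factorial : ℝ) ^ 2)⁻¹ * t.factorial) ^ (l + 1) *
      ∑ π' : Fin (l + 1) → Equiv.Perm (Fin (2 * t)),
      ∑ S : Fin (l + 1) → {S : Finset (Fin n) // S.card = t},
      ∑ π : Fin (l + 1) → Equiv.Perm (Fin (2 * t)),
      ∑ x : Fin (l + 1) → Fin (2 * t) → Fin d,
        walkCoef (slotLabel x π π') *
          ∫ ω, ∏ v, a (slotVector (fun s k => (S s).1.orderEmbOfFin (S s).2 k) v)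
            (slotLabel x π π' v) ω ∂P := by
  have hint : ∀ (S : Fin (l + 1) → {S : Finset (Fin n) // S.card = t})
      (Y : Slot (l + 1) t → Fin d),
      Integrable (fun ω => walkCoef Y *
        ∏ v, a (slotVector (fun s k => (S s).1.orderEmbOfFin (S s).2 k) v) (Y v) ω) P :=
    fun S Y => (integrable_prod ha hb _ _).const_mul _
  simp_rw [trace_symM_pow]
  rw [integral_const_mul, integral_finsetSum]
  · congr 1
    refine Finset.sum_congr rfl fun π' _ => ?_
    rw [integral_finsetSum]
    · refine Finset.sum_congr rfl fun S _ => ?_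
      rw [integral_finsetSum]
      · refine Finset.sum_congr rfl fun π _ => ?_
        rw [integral_finsetSum]
        · refine Finset.sum_congr rfl fun x _ => ?_
          rw [integral_const_mul]
        · exact fun x _ => hint S _
      · exact fun π _ => integrable_finsetSum _ fun x _ => hint S _
    · exact fun S _ => integrable_finsetSum _ fun π _ => integrable_finsetSum _ fun x _ =>
        hint S _
  · exact fun π' _ => integrable_finsetSum _ fun S _ => integrable_finsetSum _ fun π _ =>
      integrable_finsetSum _ fun x _ => hint S _

/-- The constant is `3 / 2 * 8 * 3 ^ 4 * 18 * 64`: per block, `3 / 2` from `Shift`, `8` from the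
average over row permutations, `3` for each of the four slots from the patterns, `18` from the
choice of the `t`-sets, and `64` from `vector_weight_le`. The factor `t` beside `q` comes from `t! ≤
t ^ t`. -/
lemma integral_trace_symM_pow_le (ha : ∀ i j, Measurable (a i j))
    (hind : iIndepFun (fun p : Fin n × Fin d => a p.1 p.2) P)
    (hodd : ∀ i j (k : ℕ), Odd k → ∫ ω, a i j ω ^ k ∂P = 0) {μ₄ L c q : ℝ} {l : ℕ}
    (h2 : ∀ i j, ∫ ω, a i j ω ^ 2 ∂P ≤ 1) (h4 : ∀ i j, ∫ ω, a i j ω ^ 4 ∂P ≤ μ₄)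
    (hb : ∀ i j, ∀ᵐ ω ∂P, a i j ω ^ 2 ≤ c * L) (hc : 1 ≤ c) (hμ : 1 ≤ μ₄) (ht : 1 ≤ t)
    (htd : t ≤ d) (hlL : ((l + 1 : ℕ) : ℝ) ≤ L) (hq : L ^ 6 ≤ q) (hdq : ((d : ℝ) / t * L) ^ 2 ≤ q)
    (hnq : μ₄ * n ≤ t * q) :
    ∫ ω, Matrix.trace (symM t (fun i j => a i j ω) ^ (l + 1)) ∂P ≤
      (d : ℝ) ^ (2 * t) * (1119744 * c ^ 2 * (t * q)) ^ (t * (l + 1)) := by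
  have hL1 : 1 ≤ L := le_trans (by push_cast; linarith [(Nat.cast_nonneg l : (0 : ℝ) ≤ l)]) hlL
  have hq0 : 0 < q := lt_of_lt_of_le (by positivity) hq
  have ht0 : (1 : ℝ) ≤ t := by exact_mod_cast ht
  have hy : L ^ 3 ≤ Real.sqrt q := Real.le_sqrt_of_sq_le (by rw [← pow_mul]; exact hq)
  have hxy : (d : ℝ) / t * L ≤ Real.sqrt q := Real.le_sqrt_of_sq_le hdq
  have hstep : ∀ (S : Fin (l + 1) → {S : Finset (Fin n) // S.card = t})
      (π' : Fin (l + 1) → Equiv.Perm (Fin (2 * t))),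
      ∑ π : Fin (l + 1) → Equiv.Perm (Fin (2 * t)), ∑ x : Fin (l + 1) → Fin (2 * t) → Fin d,
        walkCoef (slotLabel x π π') *
          ∫ ω, ∏ v, a (slotVector (fun s k => (S s).1.orderEmbOfFin (S s).2 k) v)
            (slotLabel x π π' v) ω ∂P ≤
      (3 / 2) ^ (t * (l + 1)) * ((d : ℝ) / t) ^ (2 * t) *
        (8 ^ t * (2 * t).factorial) ^ (l + 1) * 3 ^ (4 * t * (l + 1)) *
        ∏ i, vectorWeight μ₄ L q (64 * c ^ 2) (Finset.univ.filter fun s => i ∈ (S s).1).card := by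
    intro S π'
    have := sum_walks_le (f := fun s k => (S s).1.orderEmbOfFin (S s).2 k) ht htd hμ hlL hc hy hxy
      (fun s => ((S s).1.orderEmbOfFin (S s).2).injective)
      (fun Y => walkCoef Y *
        ∫ ω, ∏ v, a (slotVector (fun s k => (S s).1.orderEmbOfFin (S s).2 k) v) (Y v) ω ∂P)
      (G := (3 / 2) ^ (t * (l + 1))) (by positivity) ?_ ?_ π'
    · simp_rw [Real.sq_sqrt hq0.le, occurrences_orderEmbOfFin] at this
      exact this
    · intro Y hY
      by_cases hw : walkCoef Y = 0
      · simp only [hw, zero_mul]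
      · have hne : ∃ p, ¬ Even (multiplicity
            (slotVector fun s k => (S s).1.orderEmbOfFin (S s).2 k) Y p) := by
          by_contra h
          push Not at h
          exact hY ⟨h, exists_of_walkCoef_ne_zero hw⟩
        obtain ⟨p, hp⟩ := hne
        rw [integral_prod_eq_zero ha hind hodd _ _ hp, mul_zero]
    · intro Y hY
      refine mul_le_mul (walkCoef_le Y)
        (integral_prod_le ha hind (by nlinarith) hμ hb h2 h4 _ _ hY.1) ?_ (by positivity)
      rw [integral_prod_eq ha hind]
      exact Finset.prod_nonneg fun p _ => integral_nonneg fun ω => (hY.1 p).pow_nonneg _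
  have hN : (0 : ℝ) < (2 * t).factorial := by exact_mod_cast Nat.factorial_pos _
  have hT : (t.factorial : ℝ) ≤ (t : ℝ) ^ t := by exact_mod_cast Nat.factorial_le_pow t
  rw [integral_trace_symM_pow ha hb]
  have hD : ((d : ℝ) / t) ^ (2 * t) ≤ (d : ℝ) ^ (2 * t) :=
    pow_le_pow_left₀ (by positivity) (div_le_self (Nat.cast_nonneg d) ht0) _
  calc _ ≤ ((((2 * t).factorial : ℝ) ^ 2)⁻¹ * t.factorial) ^ (l + 1) *
        ∑ _π' : Fin (l + 1) → Equiv.Perm (Fin (2 * t)),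
          (3 / 2) ^ (t * (l + 1)) * ((d : ℝ) / t) ^ (2 * t) *
          (8 ^ t * (2 * t).factorial) ^ (l + 1) * 3 ^ (4 * t * (l + 1)) *
          (18 * (64 * c ^ 2) * q) ^ (t * (l + 1)) := by
        refine mul_le_mul_of_nonneg_left (Finset.sum_le_sum fun π' _ => ?_) (by positivity)
        refine (Finset.sum_le_sum fun S _ => hstep S π').trans ?_
        rw [← Finset.mul_sum]
        refine mul_le_mul_of_nonneg_left ?_ (by positivity)
        exact sum_prod_vectorWeight_le (by linarith) (by linarith) hlL hq0 (by positivity) hnq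
    -- The column permutations contribute `(2 * t)!` per factor and the row permutations another,
    -- which cancels the normalisation.
    _ = ((t.factorial : ℝ) ^ (l + 1) * ((d : ℝ) / t) ^ (2 * t)) *
        ((3 / 2 * 8 * 3 ^ 4 * (18 * (64 * c ^ 2) * q)) ^ (t * (l + 1))) := by
        rw [Finset.sum_const, Finset.card_univ, Fintype.card_fun, Fintype.card_perm,
          Fintype.card_fin, Fintype.card_fin, nsmul_eq_mul, mul_pow, mul_pow (8 ^ t : ℝ), ← pow_mul,
          mul_assoc 4, pow_mul 3 4, mul_pow (3 / 2 * 8 * 3 ^ 4 : ℝ), mul_pow (3 / 2 * 8 : ℝ),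
          mul_pow (3 / 2 : ℝ) 8, inv_pow]
        push_cast
        field_simp
        ring
    _ ≤ (((t : ℝ) ^ t) ^ (l + 1) * (d : ℝ) ^ (2 * t)) *
        ((3 / 2 * 8 * 3 ^ 4 * (18 * (64 * c ^ 2) * q)) ^ (t * (l + 1))) := by
        gcongr
    _ = _ := by
        rw [← pow_mul, mul_comm ((t : ℝ) ^ (t * (l + 1))), mul_assoc, ← mul_pow]
        congr 2
        ring

end Main

end TraceBound

theorem lemma3p7 (b : ℝ) (hb : 1 < b) (C : ℝ) (hC : 0 < C) :
    ∃ K : ℝ, 0 < K ∧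
      ∀ (n d t ℓ : ℕ) (μ₄ : ℝ) {Ω : Type*} [MeasurableSpace Ω] (P : Measure Ω)
        [IsProbabilityMeasure P] (a : Fin n → Fin d → Ω → ℝ),
        (∀ i j, Measurable (a i j)) →
        iIndepFun (fun p : Fin n × Fin d => a p.1 p.2) P →
        (∀ i j (k : ℕ), Odd k → ∫ ω, a i j ω ^ k ∂P = 0) →
        (∀ i j, ∫ ω, a i j ω ^ 2 ∂P ≤ 1) →
        (∀ i j, ∫ ω, a i j ω ^ 4 ∂P ≤ μ₄) →
        (∀ i j, ∀ᵐ ω ∂P, |a i j ω| ≤ Real.sqrt (C * Real.logb b n)) →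
        1 ≤ μ₄ →
        1 ≤ t → t ≤ d → d ≤ n →
        (t : ℝ) * Real.logb b n ^ 6 ≤ μ₄ * n + (d : ℝ) ^ 2 / t * Real.logb b n ^ 2 →
        (ℓ : ℝ) ≤ Real.logb b n →
        Integrable
            (fun ω => Matrix.trace (TraceBound.symM t (fun i j => a i j ω) ^ ℓ)) P ∧
          ∫ ω, Matrix.trace (TraceBound.symM t (fun i j => a i j ω) ^ ℓ) ∂P ≤
            (d : ℝ) ^ (2 * t) *
              (K * (μ₄ * n + (d : ℝ) ^ 2 / t * Real.logb b n ^ 2)) ^ (t * ℓ) := by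
  refine ⟨1119744 * max C 1 ^ 2, by positivity, ?_⟩
  intro n d t ℓ μ₄ Ω _ P _ a ha hind hodd h2 h4 hbd hμ ht htd hdn hL6 hlL
  -- For `ℓ = 0` the trace is that of the identity; for `ℓ ≥ 1` the bound on `ℓ` gives `1 ≤ log n`.
  rcases ℓ with _ | l
  · simp
  have hL1 : 1 ≤ Real.logb b n :=
    le_trans (by push_cast; linarith [(Nat.cast_nonneg l : (0 : ℝ) ≤ l)]) hlL
  have ht0 : (0 : ℝ) < t := by exact_mod_cast ht
  have hsq : ∀ i j, ∀ᵐ ω ∂P, a i j ω ^ 2 ≤ max C 1 * Real.logb b n := by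
    intro i j
    filter_upwards [hbd i j] with ω hω
    calc a i j ω ^ 2 = |a i j ω| ^ 2 := (sq_abs _).symm
      _ ≤ Real.sqrt (C * Real.logb b n) ^ 2 := by gcongr
      _ = C * Real.logb b n := Real.sq_sqrt (by positivity)
      _ ≤ _ := by gcongr; exact le_max_left _ _
  refine ⟨TraceBound.integrable_trace_symM_pow ha hsq l, ?_⟩
  have hn0 : 0 ≤ μ₄ * n := by positivity
  -- With `q` the target quantity divided by `t`, the three side conditions are the hypothesis on
  -- `log ^ 6` and the nonnegativity of the two summands.
  have := TraceBound.integral_trace_symM_pow_le ha hind hodd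
    (q := (μ₄ * n + (d : ℝ) ^ 2 / t * Real.logb b n ^ 2) / t) h2 h4 hsq (le_max_right _ _) hμ ht htd
    hlL ?_ ?_ ?_
  · rwa [mul_div_cancel₀ _ ht0.ne'] at this
  · rw [le_div_iff₀ ht0, mul_comm]
    exact hL6
  · rw [le_div_iff₀ ht0]
    calc ((d : ℝ) / t * Real.logb b n) ^ 2 * t = (d : ℝ) ^ 2 / t * Real.logb b n ^ 2 := by
          field_simp
      _ ≤ _ := by linarith
  · rw [mul_div_cancel₀ _ ht0.ne']
    have : 0 ≤ (d : ℝ) ^ 2 / t * Real.logb b n ^ 2 := by positivity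
    linarith
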